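/- Let $F$ be a forest, i.e. a poset in which $\{q \mid q\le p\}$ is a finite chain for every $p$. Let $\Sigma$ be the signature with one sort $p$ for each $p\in F$ and one function symbol $f_{q\le p}\colon p\to q$ for each pair $q\le p$ in $F$, and let $\mathbb T$ be the theory of functors $F^{\mathrm{op}}\to\mathbf{Set}$ in $\Sigma$, with axioms $f_{p\le p}(x)=x$ and $f_{r\le q}(f_{q\le p}(x))=f_{r\le p}(x)$; thus $\mathrm{Mod}(\mathbb T)\simeq\mathbf{Set}^{F^{\mathrm{op}}}$ via $X\mapsto M_X$, $M_X(p)=X(p)$. Let $\mathcal T$ be the syntactic category of $\mathbb T$: its objects are the formulae-in-context $\{\vec x\mid\varphi\}$ with $\varphi$ cartesian over $\mathbb T$ (built from equations by finite conjunctions and $\mathbb T$-provably unique existential quantification), and its morphisms $\{\vec x\mid\varphi\}\to\{\vec y\mid\psi\}$ are $\mathbb T$-provable equivalence classes of cartesian formulae $\theta(\vec x,\vec y)$ that are $\mathbb T$-provably functional relations. Let $\langle \vec x\mid\varphi\rangle$ be the model of $\mathbb T$ presented by $\{\vec x\mid\varphi\}$: its elements of sort $s$ are the morphisms $\{\vec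 x\mid\varphi\}\to\{y:s\mid\top\}$ of $\mathcal T$. For $A=\{\vec x\mid\varphi\}$ with $\vec x=x_1:p_1,\dots,x_n:p_n$ put $$\mathrm{Mono}\langle \vec x\mid\varphi\rangle(\vec x)\;:=\;\bigwedge_{q\in{\downarrow}\{p_1,\dots,p_n\}}\ \bigwedge_{\theta\in\mathcal T(A,\{y,y':q\mid\top\})}(\forall y,y')\Big(\big(y=y'\wedge\theta(\vec x,y,y')\big)\to\bigvee_{\delta\in\mathcal T(A,\{y,y':q\mid y=y'\}),\ \iota_q\circ\delta=\theta}\delta(\vec x,y,y')\Big),$$ where $\iota_q\colon\{y,y':q\mid y=y'\}\to\{y,y':q\mid\top\}$ is the inclusion (and each class is represented by a chosen formula). 1. $\mathrm{Mono}\langle \vec x\mid\varphi\rangle$ is a finite formula (all its conjunctions and disjunctions are finite), and for every model $M$ of $\mathbb T$, every $\vec c\in M$ satisfying $\varphi$, and the homomorphism $h\colon\langle \vec x\mid\varphi\rangle\to M$ induced by $\vec c$, the following are equivalent: (i) $h$ is a monomorphism in $\mathrm{Mod}(\mathbb T)$; (ii) for each $q\in F$ with $q\le p_i$ for some $i$,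 and all $\ell\colon\langle y,y':q\mid\top\rangle\to\langle \vec x\mid\varphi\rangle$ and $k\colon\langle y,y':q\mid y=y'\rangle\to M$ with $k\circ e_q=h\circ\ell$, where $e_q\colon\langle y,y':q\mid\top\rangle\to\langle y,y':q\mid y=y'\rangle$ takes generators to generators, there is $d\colon\langle y,y':q\mid y=y'\rangle\to\langle \vec x\mid\varphi\rangle$ with $d\circ e_q=\ell$; (iii) $M\models\mathrm{Mono}\langle \vec x\mid\varphi\rangle(\vec c)$. 2. Consequently, with $\mathrm{Mono}[p](x):=\mathrm{Mono}\langle x:p\mid\top\rangle(x)$, a finite formula: a homomorphism $h\colon\langle x:p\mid\top\rangle\to M$ taking $x$ to $c\in M(p)$ is monic iff $M\models\mathrm{Mono}[p](c)$. Call an object of $\mathbf{Set}^{F^{\mathrm{op}}}$ a path if its poset of subobjects is a finite chain. Every representable $F(-,p)$ is a path, and a morphism $F(-,p)\to X$ corresponding to $c\in X(p)$ is monic iff $M_X\models\mathrm{Mono}[p](c)$. Every path is representable or initial, and every morphism out of an initial presheaf is monic. So these finite formulae define the path embeddings of $\mathbf{Set}^{F^{\mathrm{op}}}$. -/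

import Mathlib

universe u

open CategoryTheory Opposite

namespace ForestLogic

/-- A forest: a poset in which the elements below any given one form a finite chain. -/
def IsForest (F : Type u) [PartialOrder F] : Prop :=
  ∀ p : F, (Set.Iic p).Finite ∧ IsChain (· ≤ ·) (Set.Iic p)

section SyntaxDefs

/-- Contexts `x₁ : p₁, …, xₙ : pₙ` (variables are de Bruijn indices). -/
abbrev Ctx (F : Type u) := List F

/-- `Var Γ s`: the variables of sort `s` declared in the context `Γ`. -/
inductive Var {F : Type u} : Ctx F → F → Type u
  | vz {Γ : Ctx F} {s : F} : Var (s :: Γ) s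
  | vs {Γ : Ctx F} {s p : F} (v : Var Γ s) : Var (p :: Γ) s

namespace Var

variable {F : Type u}

/-- The variables of `Δ` inside `Δ ++ Γ`. -/
def inl {Δ Γ : Ctx F} {s : F} : Var Δ s → Var (Δ ++ Γ) s
  | vz => vz
  | vs v => vs (inl v)

/-- The variables of `Γ` inside `Δ ++ Γ`. -/
def inr {Γ : Ctx F} : (Δ : Ctx F) → {s : F} → Var Γ s → Var (Δ ++ Γ) s
  | [], _, v => v
  | _ :: Δ, _, v => vs (inr Δ v)

end Var

/-- Sort-respecting assignments of elements of `X` to the variables of `Γ`,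
i.e. tuples of elements of `X` of the same sorts as the variables of `Γ`. -/
abbrev Asg {F : Type u} (X : F → Type u) (Γ : Ctx F) := (s : F) → Var Γ s → X s

namespace Asg

variable {F : Type u} {X : F → Type u}

/-- The empty tuple. -/
def nil : Asg X [] := fun _ v => nomatch v

/-- Extend a tuple by a value for the last declared variable. -/
def cons {Γ : Ctx F} {p : F} (a : X p) (ρ : Asg X Γ) : Asg X (p :: Γ)
  | _, .vz => a
  | _, .vs v => ρ _ v

/-- Juxtaposition of tuples. -/
def append {Γ : Ctx F} : (Δ : Ctx F) → Asg X Δ → Asg X Γ → Asg X (Δ ++ Γ)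
  | [], _, ρ => ρ
  | _ :: Δ, σ, ρ => cons (σ _ .vz) (append Δ (fun s v => σ s (.vs v)) ρ)

end Asg

variable {F : Type u} [PartialOrder F]

/-- Terms-in-context of the signature of functors `Fᵒᵖ ⥤ Set`: one sort for each `p : F` and
one function symbol `f_{q ≤ p} : p → q` for each pair `q ≤ p`; no relation symbols. -/
inductive Term (Γ : Ctx F) : F → Type u
  | var {s : F} (v : Var Γ s) : Term Γ s
  | app {p q : F} (h : q ≤ p) (t : Term Γ p) : Term Γ q

/-- Substitutions: tuples of terms in context `Δ`, one for each variable of `Γ`. -/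
abbrev Sub (Γ Δ : Ctx F) := Asg (Term Δ) Γ

/-- Simultaneous substitution in a term. -/
def Term.sub {Γ Δ : Ctx F} (σ : Sub Γ Δ) {s : F} : Term Γ s → Term Δ s
  | .var v => σ _ v
  | .app h t => .app h (t.sub σ)

namespace Sub

/-- The identity substitution. -/
def id (Γ : Ctx F) : Sub Γ Γ := fun _ v => .var v

/-- Weakening by one variable. -/
def wk (Γ : Ctx F) (p : F) : Sub Γ (p :: Γ) := fun _ v => .var (.vs v)

/-- Composition of substitutions (first `σ`, then `τ`). -/
def comp {Γ Δ Ξ : Ctx F} (σ : Sub Γ Δ) (τ : Sub Δ Ξ) : Sub Γ Ξ := fun s v => (σ s v).sub τ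

/-- Substitution under a binder. -/
def lift {Γ Δ : Ctx F} (p : F) (σ : Sub Γ Δ) : Sub (p :: Γ) (p :: Δ) :=
  Asg.cons (.var .vz) (comp σ (wk Δ p))

/-- Substitution of a term for the last declared variable. -/
def inst {Γ : Ctx F} {p : F} (t : Term Γ p) : Sub (p :: Γ) Γ := Asg.cons t (id Γ)

end Sub

/-- Formulae-in-context built from equations by finite conjunctions and existential
quantification. The cartesian formulae are singled out among these by `IsCartesian`. -/
inductive Fml : Ctx F → Type u
  | eq {Γ : Ctx F} {s : F} (t t' : Term Γ s) : Fml Γ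
  | top {Γ : Ctx F} : Fml Γ
  | and {Γ : Ctx F} (φ ψ : Fml Γ) : Fml Γ
  | ex {Γ : Ctx F} (p : F) (φ : Fml (p :: Γ)) : Fml Γ

namespace Fml

/-- Capture-avoiding simultaneous substitution in a formula. -/
def sub : {Γ Δ : Ctx F} → Sub Γ Δ → Fml Γ → Fml Δ
  | _, _, σ, .eq t t' => .eq (t.sub σ) (t'.sub σ)
  | _, _, _, .top => .top
  | _, _, σ, .and φ ψ => .and (φ.sub σ) (ψ.sub σ)
  | _, _, σ, .ex p φ => .ex p (φ.sub (Sub.lift p σ))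

/-- `(∃ y⃗) θ` for a tuple of variables `y⃗` declared in `Δ`. -/
def exs {Γ : Ctx F} : (Δ : Ctx F) → Fml (Δ ++ Γ) → Fml Γ
  | [], θ => θ
  | p :: Δ, θ => exs Δ (.ex p θ)

/-- The conjunction `t⃗ = t⃗'` of equations between two tuples of terms of sorts `Δ`. -/
def tupleEq {Γ : Ctx F} : (Δ : Ctx F) → Sub Δ Γ → Sub Δ Γ → Fml Γ
  | [], _, _ => .top
  | _ :: Δ, σ, τ => .and (.eq (σ _ .vz) (τ _ .vz))
      (tupleEq Δ (fun s v => σ s (.vs v)) (fun s v => τ s (.vs v)))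

end Fml

/-- A sequent `φ ⊢_Γ ψ`. -/
structure Sequent (F : Type u) [PartialOrder F] where
  ctx : Ctx F
  hyp : Fml ctx
  concl : Fml ctx

/-- Provability of sequents from a theory: the sequent calculus with the structural rules,
the rules for equality, finite conjunctions and existential quantification, and the
Frobenius axiom. Contexts are explicit, so that sorts may be interpreted by empty sets. -/
inductive Provable (T : Set (Sequent F)) : {Γ : Ctx F} → Fml Γ → Fml Γ → Prop
  | ax (S : Sequent F) (h : S ∈ T) : Provable T S.hyp S.concl
  | ident {Γ : Ctx F} (φ : Fml Γ) : Provable T φ φ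
  | cut {Γ : Ctx F} {φ ψ χ : Fml Γ} : Provable T φ ψ → Provable T ψ χ → Provable T φ χ
  | subst {Γ Δ : Ctx F} {φ ψ : Fml Γ} (σ : Sub Γ Δ) :
      Provable T φ ψ → Provable T (φ.sub σ) (ψ.sub σ)
  | eq_refl {Γ : Ctx F} {s : F} (t : Term Γ s) : Provable T .top (.eq t t)
  | eq_subst {Γ : Ctx F} {s : F} (t t' : Term Γ s) (φ : Fml (s :: Γ)) :
      Provable T (.and (.eq t t') (φ.sub (Sub.inst t))) (φ.sub (Sub.inst t'))
  | top_intro {Γ : Ctx F} (φ : Fml Γ) : Provable T φ .top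
  | and_left {Γ : Ctx F} (φ ψ : Fml Γ) : Provable T (.and φ ψ) φ
  | and_right {Γ : Ctx F} (φ ψ : Fml Γ) : Provable T (.and φ ψ) ψ
  | and_intro {Γ : Ctx F} {φ ψ χ : Fml Γ} :
      Provable T φ ψ → Provable T φ χ → Provable T φ (.and ψ χ)
  | ex_elim {Γ : Ctx F} {p : F} {φ : Fml (p :: Γ)} {ψ : Fml Γ} :
      Provable T φ (ψ.sub (Sub.wk Γ p)) → Provable T (.ex p φ) ψ
  | ex_intro {Γ : Ctx F} {p : F} {φ : Fml (p :: Γ)} {ψ : Fml Γ} :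
      Provable T (.ex p φ) ψ → Provable T φ (ψ.sub (Sub.wk Γ p))
  | frobenius {Γ : Ctx F} {p : F} (φ : Fml Γ) (ψ : Fml (p :: Γ)) :
      Provable T (.and φ (.ex p ψ)) (.ex p (.and (φ.sub (Sub.wk Γ p)) ψ))

/-- Formulae that are cartesian over `T`: existential quantifiers are `T`-provably unique. -/
inductive IsCartesian (T : Set (Sequent F)) : {Γ : Ctx F} → Fml Γ → Prop
  | eq {Γ : Ctx F} {s : F} (t t' : Term Γ s) : IsCartesian T (.eq t t')
  | top {Γ : Ctx F} : IsCartesian T (.top : Fml Γ)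
  | and {Γ : Ctx F} {φ ψ : Fml Γ} :
      IsCartesian T φ → IsCartesian T ψ → IsCartesian T (.and φ ψ)
  | ex {Γ : Ctx F} {p : F} {φ : Fml (p :: Γ)} : IsCartesian T φ →
      Provable T
        (.and (φ.sub (Asg.cons (.var .vz) (fun _ v => .var (.vs (.vs v)))))
          (φ.sub (Sub.wk (p :: Γ) p)))
        (.eq (.var .vz : Term (p :: p :: Γ) p) (.var (.vs .vz))) →
      IsCartesian T (.ex p φ)

variable (F) in
/-- The (equational) cartesian theory of functors `Fᵒᵖ ⥤ Set`, with axioms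
`⊤ ⊢_{x : p} f_{p ≤ p}(x) = x` and `⊤ ⊢_{x : p} f_{r ≤ q}(f_{q ≤ p}(x)) = f_{r ≤ p}(x)`. -/
inductive presheafTheory : Set (Sequent F)
  | map_id (p : F) : presheafTheory
      ⟨[p], .top, .eq (.app (le_refl p) (.var .vz)) (.var .vz)⟩
  | map_comp {p q r : F} (hrq : r ≤ q) (hqp : q ≤ p) : presheafTheory
      ⟨[p], .top, .eq (.app hrq (.app hqp (.var .vz))) (.app (hrq.trans hqp) (.var .vz))⟩

/-- Objects `{Γ | φ}` of the syntactic category of `T`. -/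
structure SynObj (T : Set (Sequent F)) where
  ctx : Ctx F
  fml : Fml ctx
  cartesian : IsCartesian T fml

/-- The object `{y⃗ : Δ | ⊤}`. -/
def SynObj.free (T : Set (Sequent F)) (Δ : Ctx F) : SynObj T := ⟨Δ, .top, .top⟩

/-- The object `{y, y' : q | y = y'}`. -/
def SynObj.diag (T : Set (Sequent F)) (q : F) : SynObj T :=
  ⟨[q, q], .eq (.var .vz) (.var (.vs .vz)), .eq _ _⟩

/-- `T`-provable functional relations `θ(x⃗, y⃗)` from `{x⃗ | φ}` to `{y⃗ | ψ}`. -/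
structure FunRel {T : Set (Sequent F)} (A B : SynObj T) where
  fml : Fml (B.ctx ++ A.ctx)
  cartesian : IsCartesian T fml
  le : Provable T fml
    (.and (A.fml.sub fun _ v => .var (v.inr B.ctx)) (B.fml.sub fun _ v => .var v.inl))
  unique : Provable T
    (.and
      (fml.sub (Asg.append B.ctx (fun _ v => .var v.inl)
        (fun _ v => .var ((v.inr B.ctx).inr B.ctx)) : Sub _ (B.ctx ++ (B.ctx ++ A.ctx))))
      (fml.sub fun _ v => .var (v.inr B.ctx)))
    (Fml.tupleEq B.ctx (fun _ v => .var v.inl) (fun _ v => .var (v.inl.inr B.ctx)))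
  total : Provable T A.fml (Fml.exs B.ctx fml)

/-- `T`-provable equivalence of functional relations. -/
instance FunRel.setoid {T : Set (Sequent F)} (A B : SynObj T) : Setoid (FunRel A B) where
  r θ θ' := Provable T θ.fml θ'.fml ∧ Provable T θ'.fml θ.fml
  iseqv :=
    { refl := fun _ => ⟨.ident _, .ident _⟩
      symm := fun h => ⟨h.2, h.1⟩
      trans := fun h k => ⟨.cut h.1 k.1, .cut k.2 h.2⟩ }

/-- The hom-set of the syntactic category of `T` from `A` to `B`. -/
def SynHom {T : Set (Sequent F)} (A B : SynObj T) : Type u := Quotient (FunRel.setoid A B)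

/-- Composition of functional relations with the inclusion `{y, y' : q | y = y'} → {y, y' : q | ⊤}`;
the composite of `δ(x⃗, y, y')` with this inclusion is given by the same formula. -/
def FunRel.toFree {T : Set (Sequent F)} {A : SynObj T} {q : F} (δ : FunRel A (SynObj.diag T q)) :
    FunRel A (SynObj.free T [q, q]) where
  fml := δ.fml
  cartesian := δ.cartesian
  le := .and_intro (.cut δ.le (.and_left _ _)) (.top_intro _)
  unique := δ.unique
  total := δ.total

/-- Composition with the inclusion `ι : {y, y' : q | y = y'} → {y, y' : q | ⊤}` in the syntactic
category. -/
def SynHom.toFree {T : Set (Sequent F)} {A : SynObj T} {q : F} :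
    SynHom A (SynObj.diag T q) → SynHom A (SynObj.free T [q, q]) :=
  Quotient.map FunRel.toFree fun _ _ h => h

/-- A formula representing a morphism of the syntactic category. -/
noncomputable def SynHom.fml {T : Set (Sequent F)} {A B : SynObj T} (θ : SynHom A B) :
    Fml (B.ctx ++ A.ctx) := (Quotient.out θ).fml

/-- Formulae-in-context of infinitary first-order logic over the signature of
functors `Fᵒᵖ ⥤ Set`; conjunctions and disjunctions are indexed by arbitrary small sets. -/
inductive LFml : Ctx F → Type (u + 1)
  | eq {Γ : Ctx F} {s : F} (t t' : Term Γ s) : LFml Γ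
  | neg {Γ : Ctx F} (φ : LFml Γ) : LFml Γ
  | all {Γ : Ctx F} (p : F) (φ : LFml (p :: Γ)) : LFml Γ
  | ex {Γ : Ctx F} (p : F) (φ : LFml (p :: Γ)) : LFml Γ
  | conj {Γ : Ctx F} (I : Type u) (φ : I → LFml Γ) : LFml Γ
  | disj {Γ : Ctx F} (I : Type u) (φ : I → LFml Γ) : LFml Γ

namespace LFml

/-- Binary conjunction. -/
def and {Γ : Ctx F} (φ ψ : LFml Γ) : LFml Γ :=
  .conj (ULift.{u} Bool) fun b => if b.down then φ else ψ

/-- Implication, as `¬ φ ∨ ψ`. -/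
def imp {Γ : Ctx F} (φ ψ : LFml Γ) : LFml Γ :=
  .disj (ULift.{u} Bool) fun b => if b.down then .neg φ else ψ

/-- Finite formulae: all conjunctions and disjunctions are finite. -/
def IsFinite : {Γ : Ctx F} → LFml Γ → Prop
  | _, .eq _ _ => True
  | _, .neg φ => φ.IsFinite
  | _, .all _ φ => φ.IsFinite
  | _, .ex _ φ => φ.IsFinite
  | _, .conj I φ => Finite I ∧ ∀ i, (φ i).IsFinite
  | _, .disj I φ => Finite I ∧ ∀ i, (φ i).IsFinite

end LFml

/-- Formulae built from `=, ⊤, ∧, ∃`, seen as formulae of infinitary first-order logic. -/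
def Fml.toLFml : {Γ : Ctx F} → Fml Γ → LFml Γ
  | _, .eq t t' => .eq t t'
  | _, .top => .conj PEmpty fun i => nomatch i
  | _, .and φ ψ => φ.toLFml.and ψ.toLFml
  | _, .ex p φ => .ex p φ.toLFml

/-- The formula
`⋀_{q ∈ ↓{p₁,…,pₙ}} ⋀_{θ : A → {y,y':q | ⊤}} (∀ y y' : q)
  ((y = y' ∧ θ(x⃗,y,y')) → ⋁_{δ : A → {y,y':q | y = y'}, ι ∘ δ = θ} δ(x⃗,y,y'))`
for `A = {x⃗ | φ}` with `x⃗ = x₁ : p₁, …, xₙ : pₙ`, where `θ` and `δ` range over morphisms of the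
syntactic category and `ι : {y,y':q | y = y'} → {y,y':q | ⊤}` is the inclusion. -/
noncomputable def monoFormula {T : Set (Sequent F)} (A : SynObj T) : LFml A.ctx :=
  .conj {q : F // ∃ p ∈ A.ctx, q ≤ p} fun q =>
    .conj (SynHom A (SynObj.free T [q.1, q.1])) fun θ =>
      .all q.1 <| .all q.1 <|
        LFml.imp (LFml.and (.eq (.var .vz) (.var (.vs .vz))) θ.fml.toLFml)
          (.disj {δ : SynHom A (SynObj.diag T q.1) // δ.toFree = θ} fun δ => δ.1.fml.toLFml)

end SyntaxDefs

section Semantics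

variable {F : Type u} [PartialOrder F]

variable (F) in
/-- Structures for the signature of functors `Fᵒᵖ ⥤ Set`. -/
structure Str where
  carrier : F → Type u
  map {p q : F} (h : q ≤ p) : carrier p → carrier q

/-- Interpretation of terms. -/
def Term.eval (M : Str F) {Γ : Ctx F} (ρ : Asg M.carrier Γ) {s : F} : Term Γ s → M.carrier s
  | .var v => ρ _ v
  | .app h t => M.map h (t.eval M ρ)

/-- Interpretation `ρ ∈ ⟦Γ | φ⟧_M`. -/
def Fml.Sat (M : Str F) : {Γ : Ctx F} → Fml Γ → Asg M.carrier Γ → Prop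
  | _, .eq t t', ρ => t.eval M ρ = t'.eval M ρ
  | _, .top, _ => True
  | _, .and φ ψ, ρ => φ.Sat M ρ ∧ ψ.Sat M ρ
  | _, .ex p φ, ρ => ∃ a : M.carrier p, φ.Sat M (Asg.cons a ρ)

/-- Satisfaction for infinitary first-order formulae. -/
def LFml.Sat (M : Str F) : {Γ : Ctx F} → LFml Γ → Asg M.carrier Γ → Prop
  | _, .eq t t', ρ => t.eval M ρ = t'.eval M ρ
  | _, .neg φ, ρ => ¬ φ.Sat M ρ
  | _, .all p φ, ρ => ∀ a : M.carrier p, φ.Sat M (Asg.cons a ρ)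
  | _, .ex p φ, ρ => ∃ a : M.carrier p, φ.Sat M (Asg.cons a ρ)
  | _, .conj I φ, ρ => ∀ i : I, (φ i).Sat M ρ
  | _, .disj I φ, ρ => ∃ i : I, (φ i).Sat M ρ

/-- `M` is a model of `T`: every sequent of `T` is true in `M`. -/
def Str.IsModel (T : Set (Sequent F)) (M : Str F) : Prop :=
  ∀ S ∈ T, ∀ ρ : Asg M.carrier S.ctx, S.hyp.Sat M ρ → S.concl.Sat M ρ

/-- Models of the theory `T`. -/
structure ModelOf (T : Set (Sequent F)) extends Str F where
  isModel : toStr.IsModel T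

/-- Homomorphisms of structures. -/
@[ext]
structure Str.Hom (M N : Str F) where
  toFun (s : F) : M.carrier s → N.carrier s
  map_app {p q : F} (h : q ≤ p) (a : M.carrier p) : toFun q (M.map h a) = N.map h (toFun p a)

/-- The category of models of `T` and homomorphisms of structures. -/
instance (T : Set (Sequent F)) : Category (ModelOf T) where
  Hom M N := Str.Hom M.toStr N.toStr
  id M := ⟨fun _ a => a, fun _ _ => rfl⟩
  comp f g := ⟨fun s a => g.toFun s (f.toFun s a), fun h a => by rw [f.map_app, g.map_app]⟩

end Semantics

section Lemmas

theorem Asg.cons_eta {F : Type u} {X : F → Type u} {Γ : Ctx F} {p : F} (ρ : Asg X (p :: Γ)) :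
    Asg.cons (ρ p .vz) (fun s v => ρ s (.vs v)) = ρ := by
  funext s v; cases v <;> rfl

variable {F : Type u} [PartialOrder F]

theorem Term.sub_sub {Γ Δ Ξ : Ctx F} (σ : Sub Γ Δ) (τ : Sub Δ Ξ) {s : F} (t : Term Γ s) :
    (t.sub σ).sub τ = t.sub (Sub.comp σ τ) := by
  induction t with
  | var v => rfl
  | app h t ih => simp only [Term.sub, ih]

theorem Term.sub_id {Γ : Ctx F} {s : F} (t : Term Γ s) : t.sub (Sub.id Γ) = t := by
  induction t with
  | var v => rfl
  | app h t ih => simp only [Term.sub, ih]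

theorem Sub.comp_cons {Γ Δ Ξ : Ctx F} {p : F} (t : Term Δ p) (σ : Sub Γ Δ) (τ : Sub Δ Ξ) :
    Sub.comp (Asg.cons t σ) τ = Asg.cons (t.sub τ) (Sub.comp σ τ) := by
  funext s v; cases v <;> rfl

theorem Sub.wk_comp {Γ Δ : Ctx F} {p : F} (σ : Sub (p :: Γ) Δ) :
    Sub.comp (Sub.wk Γ p) σ = fun s v => σ s (.vs v) := rfl

theorem Sub.comp_assoc {Γ Δ Ξ Ω : Ctx F} (σ : Sub Γ Δ) (τ : Sub Δ Ξ) (υ : Sub Ξ Ω) :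
    Sub.comp (Sub.comp σ τ) υ = Sub.comp σ (Sub.comp τ υ) := by
  funext s v; exact Term.sub_sub _ _ _

theorem Sub.comp_lift {Γ Δ Ξ : Ctx F} (p : F) (σ : Sub Γ Δ) (τ : Sub Δ Ξ) :
    Sub.comp (Sub.lift p σ) (Sub.lift p τ) = Sub.lift p (Sub.comp σ τ) := by
  simp only [Sub.lift, Sub.comp_cons, Sub.comp_assoc]; rfl

theorem Sub.lift_id (Γ : Ctx F) (p : F) : Sub.lift p (Sub.id Γ) = Sub.id (p :: Γ) := by
  funext s v; cases v <;> rfl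

theorem Fml.sub_sub {Γ Δ Ξ : Ctx F} (σ : Sub Γ Δ) (τ : Sub Δ Ξ) (φ : Fml Γ) :
    (φ.sub σ).sub τ = φ.sub (Sub.comp σ τ) := by
  induction φ generalizing Δ Ξ with
  | eq t t' => simp only [Fml.sub, Term.sub_sub]
  | top => rfl
  | and φ ψ ih ih' => simp only [Fml.sub, ih, ih']
  | ex p φ ih => simp only [Fml.sub, ih, Sub.comp_lift]

theorem Fml.sub_id {Γ : Ctx F} (φ : Fml Γ) : φ.sub (Sub.id Γ) = φ := by
  induction φ with
  | eq t t' => simp only [Fml.sub, Term.sub_id]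
  | top => rfl
  | and φ ψ ih ih' => simp only [Fml.sub, ih, ih']
  | ex p φ ih => simp only [Fml.sub, Sub.lift_id, ih]

/-! Substitution and satisfaction. -/

theorem Term.eval_sub (M : Str F) {Γ Δ : Ctx F} (σ : Sub Γ Δ) (ρ : Asg M.carrier Δ) {s : F}
    (t : Term Γ s) : (t.sub σ).eval M ρ = t.eval M (fun s v => (σ s v).eval M ρ) := by
  induction t with
  | var v => rfl
  | app h t ih => simp only [Term.sub, Term.eval, ih]

theorem Fml.sat_sub (M : Str F) {Γ Δ : Ctx F} (σ : Sub Γ Δ) (ρ : Asg M.carrier Δ)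
    (φ : Fml Γ) : (φ.sub σ).Sat M ρ ↔ φ.Sat M (fun s v => (σ s v).eval M ρ) := by
  induction φ generalizing Δ with
  | eq t t' => simp only [Fml.sub, Fml.Sat, Term.eval_sub]
  | top => rfl
  | and φ ψ ih ih' => simp only [Fml.sub, Fml.Sat, ih, ih']
  | ex p φ ih =>
    simp only [Fml.sub, Fml.Sat, ih]
    refine exists_congr fun a => ?_
    have : (fun s v => (Sub.lift p σ s v).eval M (Asg.cons a ρ)) =
        Asg.cons a (fun s v => (σ s v).eval M ρ) := by
      funext s v
      cases v with
      | vz => rfl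
      | vs v => simp only [Sub.lift, Asg.cons, Sub.comp, Term.eval_sub]; rfl
    rw [this]

/-- Soundness. -/
theorem Provable.sound {T : Set (Sequent F)} {M : Str F} (hM : M.IsModel T) {Γ : Ctx F}
    {φ ψ : Fml Γ} (h : Provable T φ ψ) (ρ : Asg M.carrier Γ) : φ.Sat M ρ → ψ.Sat M ρ := by
  induction h with
  | ax S h => exact hM S h ρ
  | ident => exact fun h => h
  | cut _ _ ih ih' => exact fun h => ih' ρ (ih ρ h)
  | subst σ _ ih => rw [Fml.sat_sub, Fml.sat_sub]; exact ih _
  | eq_refl t => exact fun _ => rfl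
  | eq_subst t t' φ =>
    rintro ⟨h1, h2⟩
    rw [Fml.sat_sub] at h2 ⊢
    convert h2 using 1
    funext s v
    cases v with
    | vz => exact h1.symm
    | vs v => rfl
  | top_intro => exact fun _ => trivial
  | and_left => exact fun h => h.1
  | and_right => exact fun h => h.2
  | and_intro _ _ ih ih' => exact fun h => ⟨ih ρ h, ih' ρ h⟩
  | ex_elim _ ih =>
    rintro ⟨a, ha⟩
    exact (Fml.sat_sub _ _ _ _).1 (ih _ ha)
  | ex_intro _ ih =>
    intro h
    exact (Fml.sat_sub _ _ _ _).2 (ih _ ⟨ρ _ .vz, by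
      convert h using 1; exact Asg.cons_eta ρ⟩)
  | frobenius φ ψ =>
    rintro ⟨h, a, ha⟩
    exact ⟨a, (Fml.sat_sub _ _ _ _).2 h, ha⟩

namespace Provable

variable {T : Set (Sequent F)}

theorem eq_symm {Γ : Ctx F} {s : F} {χ : Fml Γ} {t t' : Term Γ s}
    (h : Provable T χ (.eq t t')) : Provable T χ (.eq t' t) := by
  have := eq_subst (T := T) t t' (.eq (.var .vz) (t.sub (Sub.wk Γ s)))
  simp only [Fml.sub, Term.sub, Term.sub_sub, Sub.inst, Asg.cons, Sub.wk_comp] at this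
  change Provable T (.and (.eq t t') (.eq t (t.sub (Sub.id Γ)))) (.eq t' (t.sub (Sub.id Γ)))
    at this
  rw [Term.sub_id] at this
  exact cut (and_intro h (cut (top_intro _) (eq_refl t))) this

/-- Replacing equals by equals. -/
theorem rewrite {Γ : Ctx F} {s : F} {χ : Fml Γ} {t t' : Term Γ s} (φ : Fml (s :: Γ))
    (h : Provable T χ (.eq t t')) (h' : Provable T χ (φ.sub (Sub.inst t))) :
    Provable T χ (φ.sub (Sub.inst t')) :=
  cut (and_intro h h') (eq_subst t t' φ)

theorem eq_trans {Γ : Ctx F} {s : F} {χ : Fml Γ} {t t' t'' : Term Γ s}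
    (h : Provable T χ (.eq t t')) (h' : Provable T χ (.eq t' t'')) :
    Provable T χ (.eq t t'') := by
  have := rewrite (T := T) (.eq (t.sub (Sub.wk Γ s)) (.var .vz)) h' (χ := χ)
  simp only [Fml.sub, Term.sub, Term.sub_sub, Sub.inst, Asg.cons, Sub.wk_comp] at this
  change Provable T χ (.eq (t.sub (Sub.id Γ)) t') →
    Provable T χ (.eq (t.sub (Sub.id Γ)) t'') at this
  rw [Term.sub_id] at this
  exact this h

theorem eq_app {Γ : Ctx F} {p q : F} (hq : q ≤ p) {χ : Fml Γ} {t t' : Term Γ p}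
    (h : Provable T χ (.eq t t')) : Provable T χ (.eq (.app hq t) (.app hq t')) := by
  have := rewrite (T := T) (.eq (.app hq (t.sub (Sub.wk Γ p))) (.app hq (.var .vz))) h (χ := χ)
  simp only [Fml.sub, Term.sub, Term.sub_sub, Sub.inst, Asg.cons, Sub.wk_comp] at this
  change Provable T χ (.eq (.app hq (t.sub (Sub.id Γ))) (.app hq t)) →
    Provable T χ (.eq (.app hq (t.sub (Sub.id Γ))) (.app hq t')) at this
  rw [Term.sub_id] at this
  exact this (cut (top_intro _) (eq_refl _))

/-- Introduction of an existential quantifier with a witness. -/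
theorem ex_wit {Γ : Ctx F} {p : F} {χ : Fml Γ} {φ : Fml (p :: Γ)} (t : Term Γ p)
    (h : Provable T χ (φ.sub (Sub.inst t))) : Provable T χ (.ex p φ) := by
  have := subst (Sub.inst t) (ex_intro (ident (T := T) (.ex p φ)))
  rw [Fml.sub_sub] at this
  change Provable T _ ((Fml.ex p φ).sub (Sub.id Γ)) at this
  rw [Fml.sub_id] at this
  exact cut h this

/-- Elimination of an existential quantifier in context. -/
theorem ex_use {Γ : Ctx F} {p : F} {χ ξ : Fml Γ} {φ : Fml (p :: Γ)}
    (h : Provable T χ (.ex p φ))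
    (h' : Provable T (.and (χ.sub (Sub.wk Γ p)) φ) (ξ.sub (Sub.wk Γ p))) :
    Provable T χ ξ :=
  cut (and_intro (ident χ) h) (cut (frobenius χ φ) (ex_elim h'))

theorem left {Γ : Ctx F} {χ φ ψ : Fml Γ} (h : Provable T χ (.and φ ψ)) : Provable T χ φ :=
  cut h (and_left _ _)

theorem right {Γ : Ctx F} {χ φ ψ : Fml Γ} (h : Provable T χ (.and φ ψ)) : Provable T χ ψ :=
  cut h (and_right _ _)

end Provable

theorem IsCartesian.sub {T : Set (Sequent F)} {Γ Δ : Ctx F} {φ : Fml Γ}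
    (h : IsCartesian T φ) (σ : Sub Γ Δ) : IsCartesian T (φ.sub σ) := by
  induction h generalizing Δ with
  | eq => exact .eq _ _
  | top => exact .top
  | and _ _ ih ih' => exact .and (ih σ) (ih' σ)
  | @ex Γ p φ _ hu ih =>
    refine .ex (ih _) ?_
    have := Provable.subst (Sub.lift p (Sub.lift p σ)) hu
    simp only [Fml.sub, Fml.sub_sub] at this ⊢
    have e1 : Sub.comp (Sub.lift p σ) (Asg.cons (.var .vz) fun _ v => .var (.vs (.vs v))) =
        Sub.comp (Asg.cons (.var .vz) fun _ v => .var (.vs (.vs v)))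
          (Sub.lift p (Sub.lift p σ)) := by
      funext s v
      cases v with
      | vz => rfl
      | vs v =>
        exact (Term.sub_sub (Sub.wk Δ p) _ (σ s v)).trans
          (Term.sub_sub (Sub.wk Δ p) (Sub.wk (p :: Δ) p) (σ s v)).symm
    have e2 : Sub.comp (Sub.lift p σ) (Sub.wk (p :: Δ) p) =
        Sub.comp (Sub.wk (p :: Γ) p) (Sub.lift p (Sub.lift p σ)) := rfl
    rw [e1, e2]
    exact this

end Lemmas

section Presented

variable {F : Type u} [PartialOrder F] {T : Set (Sequent F)}

/-- Functional relations with values in a single sort. -/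
structure IsFun (T : Set (Sequent F)) {Γ : Ctx F} {s : F} (φ : Fml Γ) (θ : Fml (s :: Γ)) :
    Prop where
  cartesian : IsCartesian T θ
  le : Provable T θ (φ.sub (Sub.wk Γ s))
  unique : Provable T
    (.and (θ.sub (Asg.cons (.var .vz) fun _ v => .var (.vs (.vs v))))
      (θ.sub (Sub.wk (s :: Γ) s)))
    (.eq (.var .vz : Term (s :: s :: Γ) s) (.var (.vs .vz)))
  total : Provable T φ (.ex s θ)

theorem Fml.sub_cons_sub {Γ Δ Ξ : Ctx F} {s : F} (θ : Fml (s :: Γ)) (t : Term Δ s)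
    (σ : Sub Γ Δ) (τ : Sub Δ Ξ) :
    (θ.sub (Asg.cons t σ)).sub τ = θ.sub (Asg.cons (t.sub τ) (Sub.comp σ τ)) := by
  rw [Fml.sub_sub, Sub.comp_cons]

theorem Sub.wk_eq (Γ : Ctx F) (s p : F) :
    Sub.wk (s :: Γ) p = Asg.cons (.var (.vs .vz)) fun _ v => .var (.vs (.vs v)) := by
  funext s v; cases v <;> rfl

theorem Sub.id_eq (Γ : Ctx F) (s : F) :
    Sub.id (s :: Γ) = Asg.cons (.var .vz) fun _ v => .var (.vs v) := by
  funext s v; cases v <;> rfl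

namespace IsFun

variable {Γ : Ctx F} {s p q : F} {φ : Fml Γ}

/-- Uniqueness for two arbitrary terms. -/
theorem unique_terms {θ : Fml (s :: Γ)} (hθ : IsFun T φ θ) {Δ : Ctx F} (σ : Sub Γ Δ)
    {χ : Fml Δ} {t t' : Term Δ s} (h : Provable T χ (θ.sub (Asg.cons t σ)))
    (h' : Provable T χ (θ.sub (Asg.cons t' σ))) : Provable T χ (.eq t t') := by
  have := Provable.subst (Asg.cons t (Asg.cons t' σ)) hθ.unique
  rw [Sub.wk_eq] at this
  simp only [Fml.sub, Fml.sub_cons_sub] at this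
  exact .cut (.and_intro h h') this

theorem le_terms {θ : Fml (s :: Γ)} (hθ : IsFun T φ θ) {Δ : Ctx F} (σ : Sub Γ Δ)
    {χ : Fml Δ} {t : Term Δ s} (h : Provable T χ (θ.sub (Asg.cons t σ))) :
    Provable T χ (φ.sub σ) := by
  have := Provable.subst (Asg.cons t σ) hθ.le
  rw [Fml.sub_sub] at this
  exact h.cut this

/-- For functional relations, provable implication suffices for provable equivalence. -/
theorem converse {θ θ' : Fml (s :: Γ)} (hθ : IsFun T φ θ) (hθ' : IsFun T φ θ')
    (h : Provable T θ θ') : Provable T θ' θ := by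
  refine Provable.ex_use (hθ'.le.cut (Provable.subst (Sub.wk Γ s) hθ.total)) ?_
  have hl := Provable.and_left (T := T) (Fml.sub (Sub.wk (s :: Γ) s) θ')
    (Fml.sub (Sub.lift s (Sub.wk Γ s)) θ)
  have hr := Provable.and_right (T := T) (Fml.sub (Sub.wk (s :: Γ) s) θ')
    (Fml.sub (Sub.lift s (Sub.wk Γ s)) θ)
  have h2 := hr.cut (Provable.subst (Sub.lift s (Sub.wk Γ s)) h)
  have hl' := hl
  rw (occs := .pos [2]) [Sub.wk_eq] at hl'
  have h3 := hθ'.unique_terms (fun _ v => .var (.vs (.vs v))) h2 hl'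
  have h4 := Provable.rewrite
    (θ.sub (Asg.cons (.var .vz) (fun _ v => .var (.vs (.vs (.vs v)))))) h3
  simp only [Fml.sub_cons_sub] at h4
  have h5 := h4 hr
  rw (occs := .pos [2]) [Sub.wk_eq]
  exact h5

/-- The formula `(∃ y : p) (θ(x⃗, y) ∧ z = f_{q ≤ p}(y))`. -/
def appFml (h : q ≤ p) (θ : Fml (p :: Γ)) : Fml (q :: Γ) :=
  .ex p (.and (θ.sub (Asg.cons (.var .vz) fun _ v => .var (.vs (.vs v))))
    (.eq (.var (.vs .vz)) (.app h (.var .vz))))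

/-- Introduction rule for `appFml`. -/
theorem appFml_intro (h : q ≤ p) (θ : Fml (p :: Γ)) {Δ : Ctx F} (σ : Sub Γ Δ) {χ : Fml Δ}
    {t : Term Δ q} (w : Term Δ p) (h1 : Provable T χ (θ.sub (Asg.cons w σ)))
    (h2 : Provable T χ (.eq t (.app h w))) :
    Provable T χ ((appFml h θ).sub (Asg.cons t σ)) := by
  refine Provable.ex_wit w ?_
  simp only [Fml.sub, Fml.sub_cons_sub]
  refine .and_intro ?_ ?_
  · convert h1 using 2
    simp only [Sub.inst, Asg.cons, Sub.lift, Term.sub]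
    congr 1
    funext s v
    change ((σ s v).sub (Sub.wk Δ p)).sub _ = _
    rw [Term.sub_sub]
    exact Term.sub_id _
  · convert h2 using 2
    · change (t.sub (Sub.wk Δ p)).sub _ = _
      rw [Term.sub_sub]
      exact Term.sub_id _
    · rfl

/-- Elimination rule for `appFml`. -/
theorem appFml_elim (h : q ≤ p) (θ : Fml (p :: Γ)) {Δ : Ctx F} (σ : Sub Γ Δ) {χ ξ : Fml Δ}
    {t : Term Δ q} (h1 : Provable T χ ((appFml h θ).sub (Asg.cons t σ)))
    (h2 : ∀ χ' : Fml (p :: Δ), Provable T χ' (χ.sub (Sub.wk Δ p)) →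
      Provable T χ' (θ.sub (Asg.cons (.var .vz) (Sub.comp σ (Sub.wk Δ p)))) →
      Provable T χ' (.eq (t.sub (Sub.wk Δ p)) (.app h (.var .vz))) →
      Provable T χ' (ξ.sub (Sub.wk Δ p))) :
    Provable T χ ξ := by
  refine Provable.ex_use h1 (h2 _ (.and_left _ _) ?_ (Provable.and_right _ _).right)
  refine (Provable.and_right _ _).cut ((Provable.and_left _ _).cut ?_)
  simp only [Fml.sub_cons_sub]
  exact .ident _

theorem weaken_hyp {θ : Fml (p :: Γ)} {Δ : Ctx F} {σ : Sub Γ Δ} {χ : Fml Δ} {t : Term Δ p}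
    {χ' : Fml (q :: Δ)} (h : Provable T χ' (χ.sub (Sub.wk Δ q)))
    (h1 : Provable T χ (θ.sub (Asg.cons t σ))) :
    Provable T χ'
      (θ.sub (Asg.cons (t.sub (Sub.wk Δ q)) (Sub.comp σ (Sub.wk Δ q)))) := by
  rw [← Fml.sub_cons_sub]
  exact h.cut (.subst _ h1)

theorem app (h : q ≤ p) {θ : Fml (p :: Γ)} (hθ : IsFun T φ θ) :
    IsFun T φ (appFml h θ) where
  cartesian := by
    refine .ex (.and (hθ.cartesian.sub _) (.eq _ _)) ?_
    rw [Sub.wk_eq]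
    simp only [Fml.sub, Fml.sub_cons_sub]
    exact hθ.unique_terms (fun _ v => .var (.vs (.vs (.vs v))))
      (Provable.and_left _ _).left (Provable.and_right _ _).left
  le := by
    have : Provable T (appFml h θ) ((appFml h θ).sub (Sub.id _)) := by
      rw [Fml.sub_id]; exact .ident _
    rw [Sub.id_eq] at this
    refine appFml_elim h θ _ this fun χ' _ h2 _ => ?_
    rw [Fml.sub_sub]
    exact hθ.le_terms _ h2
  unique := by
    rw [Sub.wk_eq]
    refine appFml_elim h θ _ (Provable.and_left _ _) fun χ' a b c => ?_
    refine appFml_elim h θ (fun _ v => .var (.vs (.vs (.vs v)))) (t := .var (.vs (.vs .vz)))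
      (a.right.cut ?_) fun χ'' a' b' c' => ?_
    · simp only [Fml.sub_cons_sub]
      exact .ident _
    · have u := hθ.unique_terms _ (weaken_hyp a' b) b'
      exact (a'.cut (.subst _ c)).eq_trans ((Provable.eq_app h u).eq_trans c'.eq_symm)
  total := by
    refine hθ.total.cut (.ex_elim (Provable.ex_wit (.app h (.var .vz)) ?_))
    rw [Fml.sub_sub]
    have e : Sub.comp (Sub.lift q (Sub.wk Γ p)) (Sub.inst (.app h (.var .vz))) =
        Asg.cons (.app h (.var .vz)) (Sub.wk Γ p) := by
      funext s v; cases v <;> rfl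
    rw [e]
    refine appFml_intro h θ _ (.var .vz) ?_ (.cut (.top_intro _) (.eq_refl _))
    have e' : θ.sub (Asg.cons (.var .vz) (Sub.wk Γ p)) = θ :=
      (congrArg (fun τ => θ.sub τ) (Sub.id_eq Γ p).symm).trans (Fml.sub_id θ)
    rw [e']
    exact .ident θ

theorem app_congr (h : q ≤ p) {θ θ' : Fml (p :: Γ)} (hle : Provable T θ θ') :
    Provable T (appFml h θ) (appFml h θ') := by
  have : Provable T (appFml h θ) ((appFml h θ).sub (Sub.id _)) := by
    rw [Fml.sub_id]; exact .ident _
  rw [Sub.id_eq] at this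
  refine appFml_elim h θ _ this fun χ' _ h2 h3 => ?_
  rw [Sub.wk_eq]
  exact appFml_intro h θ' _ _ (h2.cut (.subst _ hle)) h3

theorem app_id {θ : Fml (p :: Γ)} :
    Provable (presheafTheory F) (appFml (le_refl p) θ) θ := by
  have : Provable (presheafTheory F) (appFml (le_refl p) θ)
      ((appFml (le_refl p) θ).sub (Sub.id _)) := by
    rw [Fml.sub_id]; exact .ident _
  rw [Sub.id_eq] at this
  refine appFml_elim (le_refl p) θ _ this fun χ' _ h2 h3 => ?_
  have ax : Provable (presheafTheory F) χ' (.eq (.app (le_refl p) (.var .vz)) (.var .vz)) :=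
    (Provable.top_intro _).cut
      (Provable.subst (Asg.cons (.var .vz) Asg.nil) (.ax _ (presheafTheory.map_id p)))
  have := (h3.eq_trans ax).eq_symm.rewrite
    (θ.sub (Asg.cons (.var .vz) (fun _ v => .var (.vs (.vs (.vs v))))))
  simp only [Fml.sub_cons_sub] at this
  rw [Sub.wk_eq]
  exact this h2

theorem app_app {r : F} (hrq : r ≤ q) (hqp : q ≤ p) {θ : Fml (p :: Γ)} :
    Provable (presheafTheory F) (appFml hrq (appFml hqp θ)) (appFml (hrq.trans hqp) θ) := by
  have : Provable (presheafTheory F) (appFml hrq (appFml hqp θ))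
      ((appFml hrq (appFml hqp θ)).sub (Sub.id _)) := by
    rw [Fml.sub_id]; exact .ident _
  rw [Sub.id_eq] at this
  refine appFml_elim hrq _ _ this fun χ' _ h2 h3 => ?_
  refine appFml_elim hqp _ _ h2 fun χ'' a b c => ?_
  have ax : Provable (presheafTheory F) χ'' (.eq (.app hrq (.app hqp (.var .vz)))
      (.app (hrq.trans hqp) (.var .vz))) :=
    (Provable.top_intro _).cut
      (Provable.subst (Asg.cons (.var .vz) Asg.nil) (.ax _ (presheafTheory.map_comp hrq hqp)))
  have e := ((a.cut (.subst _ h3)).eq_trans (Provable.eq_app hrq c)).eq_trans ax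
  rw [Fml.sub_sub]
  have := appFml_intro (hrq.trans hqp) θ _ _ b e
  convert this using 2
  funext s v; cases v <;> rfl

end IsFun

theorem FunRel.isFun {A : SynObj T} {s : F} (θ : FunRel A (SynObj.free T [s])) :
    IsFun T (s := s) A.fml θ.fml :=
  ⟨θ.cartesian, θ.le.left, θ.unique.left, θ.total⟩

/-- A functional relation with values in a single sort, as a functional relation from `A`
to `{y : s | ⊤}`. -/
def IsFun.toFunRel {A : SynObj T} {s : F} {θ : Fml (s :: A.ctx)} (h : IsFun T A.fml θ) :
    FunRel A (SynObj.free T [s]) where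
  fml := θ
  cartesian := h.cartesian
  le := h.le.and_intro (.top_intro _)
  unique := Provable.and_intro h.unique (.top_intro _)
  total := h.total

/-- Composition with the function symbol `f_{q ≤ p}`. -/
def SynHom.app {A : SynObj T} {p q : F} (h : q ≤ p) :
    SynHom A (SynObj.free T [p]) → SynHom A (SynObj.free T [q]) :=
  Quotient.map (fun θ => (θ.isFun.app h).toFunRel) fun _ _ e =>
    ⟨IsFun.app_congr h e.1, IsFun.app_congr h e.2⟩

/-- The underlying structure of the model presented by `A = {x⃗ | φ}`: the set of elements of
sort `s` is the hom-set from `A` to `{y : s | ⊤}` in the syntactic category, and function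
symbols act by composition. -/
def presentedStr (A : SynObj T) : Str F where
  carrier s := SynHom A (SynObj.free T [s])
  map h := SynHom.app h

/-- The finitely presentable model `⟨x⃗ | φ⟩` presented by `A = {x⃗ | φ}`. -/
def presented (A : SynObj (presheafTheory F)) : ModelOf (presheafTheory F) where
  toStr := presentedStr A
  isModel := by
    rintro S (⟨p⟩ | ⟨hrq, hqp⟩) ρ -
    · change SynHom.app (le_refl p) (ρ p .vz) = ρ p .vz
      induction ρ p .vz using Quotient.inductionOn with
      | h θ =>
        exact Quotient.sound
          ⟨IsFun.app_id, (θ.isFun.app _).converse θ.isFun IsFun.app_id⟩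
    · rename_i p q r
      change SynHom.app hrq (SynHom.app hqp (ρ p .vz)) = SynHom.app (hrq.trans hqp) (ρ p .vz)
      induction ρ p .vz using Quotient.inductionOn with
      | h θ =>
        exact Quotient.sound
          ⟨IsFun.app_app hrq hqp, ((θ.isFun.app hqp).app hrq).converse
            (θ.isFun.app _) (IsFun.app_app hrq hqp)⟩

end Presented

section Homs

variable {F : Type u} [PartialOrder F] {T : Set (Sequent F)}

/-- The generator of `⟨x⃗ | φ⟩` named by a variable `xᵢ`: the projection with graph
`φ(x⃗) ∧ xᵢ = y`. -/
def generator (A : SynObj T) : Asg (presentedStr A).carrier A.ctx := fun s v =>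
  Quotient.mk _ (IsFun.toFunRel (A := A) (s := s)
    (θ := .and (A.fml.sub (Sub.wk A.ctx s)) (.eq (.var (.vs v)) (.var .vz)))
    { cartesian := .and (A.cartesian.sub _) (.eq _ _)
      le := .and_left _ _
      unique := ((Provable.and_left _ _).right.eq_symm).eq_trans (Provable.and_right _ _).right
      total := by
        refine .ex_wit (.var v) (.and_intro ?_ (.cut (.top_intro _) (.eq_refl _)))
        rw [Fml.sub_sub]
        change Provable T _ (A.fml.sub (Sub.id _))
        rw [Fml.sub_id]
        exact .ident _ })

theorem SynHom.isFun {A : SynObj T} {s : F} (θ : SynHom A (SynObj.free T [s])) :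
    IsFun T (s := s) A.fml θ.fml :=
  FunRel.isFun _

/-- In a model, a functional relation is the graph of a function on `⟦x⃗ | φ⟧`. -/
theorem IsFun.existsUnique {M : Str F} (hM : M.IsModel T) {Γ : Ctx F} {s : F} {φ : Fml Γ}
    {θ : Fml (s :: Γ)} (h : IsFun T φ θ) (c : Asg M.carrier Γ) (hc : φ.Sat M c) :
    ∃! b : M.carrier s, θ.Sat M (Asg.cons b c) := by
  obtain ⟨b, hb⟩ := h.total.sound hM c hc
  refine ⟨b, hb, fun b' hb' => ?_⟩
  refine h.unique.sound hM (Asg.cons b' (Asg.cons b c)) ⟨?_, ?_⟩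
  · rw [Fml.sat_sub]
    convert hb' using 1
    funext s v; cases v <;> rfl
  · rw [Fml.sat_sub]
    exact hb

theorem IsFun.sat_appFml {M : Str F} {Γ : Ctx F} {p q : F} (h : q ≤ p) (θ : Fml (p :: Γ))
    (c : Asg M.carrier Γ) (b : M.carrier p) (hb : θ.Sat M (Asg.cons b c)) :
    (IsFun.appFml h θ).Sat M (Asg.cons (M.map h b) c) := by
  refine ⟨b, (Fml.sat_sub _ _ _ _).2 ?_, rfl⟩
  convert hb using 1
  funext s v; cases v <;> rfl

/-- The homomorphism `⟨x⃗ | φ⟩ → M` induced by `c⃗ ∈ ⟦x⃗ | φ⟧_M`, i.e. taking `x⃗` to `c⃗`: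
it sends the class of `θ(x⃗, y)` to the unique `b` such that `M ⊨ θ(c⃗, b)`. -/
noncomputable def inducedHom {A : SynObj (presheafTheory F)} {M : ModelOf (presheafTheory F)}
    (c : Asg M.carrier A.ctx) (hc : A.fml.Sat M.toStr c) : presented A ⟶ M where
  toFun s θ := (θ.isFun.existsUnique M.isModel c hc).choose
  map_app := by
    intro p q h θ
    have h1 := (θ.isFun.existsUnique M.isModel c hc).choose_spec.1
    refine (((SynHom.app h θ).isFun.existsUnique M.isModel c hc).choose_spec.2 _ ?_).symm
    have key : Provable (presheafTheory F) (IsFun.appFml h θ.fml)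
        ((SynHom.app h θ).fml : Fml (q :: A.ctx)) := by
      have e : SynHom.app h θ = Quotient.mk _ ((FunRel.isFun θ.out).app h).toFunRel := by
        conv_lhs => rw [← Quotient.out_eq θ]
        rfl
      have e' := Quotient.exact ((Quotient.out_eq (SynHom.app h θ)).trans e)
      exact e'.2
    exact key.sound M.isModel _ (IsFun.sat_appFml h _ c _ h1)

/-- The homomorphism `⟨y, y' : q | ⊤⟩ → ⟨y, y' : q | y = y'⟩` taking `y, y'` to the
generators `y, y'`. -/
noncomputable def diagQuotient (q : F) :
    presented (SynObj.free (presheafTheory F) [q, q]) ⟶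
      presented (SynObj.diag (presheafTheory F) q) :=
  inducedHom (A := SynObj.free (presheafTheory F) [q, q])
    (generator (SynObj.diag (presheafTheory F) q)) trivial

/-- For `h : N ⟶ M`: every commutative square from `⟨y,y' : q | ⊤⟩ → ⟨y,y' : q | y = y'⟩` to
`h` admits a morphism `d : ⟨y,y' : q | y = y'⟩ ⟶ N` making the upper left triangle commute. -/
def HasDiagonals {N M : ModelOf (presheafTheory F)} (h : N ⟶ M) (q : F) : Prop :=
  ∀ (l : presented (SynObj.free (presheafTheory F) [q, q]) ⟶ N)
    (k : presented (SynObj.diag (presheafTheory F) q) ⟶ M),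
    diagQuotient q ≫ k = l ≫ h →
      ∃ d : presented (SynObj.diag (presheafTheory F) q) ⟶ N, diagQuotient q ≫ d = l

end Homs

section Presheaves

variable {F : Type u} [PartialOrder F]

/-- The model `M_X` of the theory of functors associated with a presheaf `X`. -/
def modelOfPresheaf (X : Fᵒᵖ ⥤ Type u) : ModelOf (presheafTheory F) where
  carrier p := X.obj (op p)
  map h := X.map (homOfLE h).op
  isModel := by
    rintro S (⟨p⟩ | ⟨hrq, hqp⟩) ρ -
    · exact X.map_id_apply _ _
    · exact (X.map_comp_apply (homOfLE hqp).op (homOfLE hrq).op _).symm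

variable (F) in
/-- The functor from presheaves on `F` to models of the theory of functors. -/
def presheafToMod : (Fᵒᵖ ⥤ Type u) ⥤ ModelOf (presheafTheory F) where
  obj := modelOfPresheaf
  map f := ⟨fun s a => f.app (op s) a, fun h a => NatTrans.naturality_apply f (homOfLE h).op a⟩
  map_id _ := rfl
  map_comp _ _ := rfl

/-- A path in a category, for the factorisation system (epis, monos):
an object whose poset of subobjects is a finite chain. -/
def IsPath {C : Type*} [Category C] (P : C) : Prop :=
  Finite (Subobject P) ∧ ∀ A B : Subobject P, A ≤ B ∨ B ≤ A

end Presheaves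

end ForestLogic

open ForestLogic

/-!
The point is that the elements of the model `⟨x⃗ | φ⟩` presented by a cartesian formula are named by
terms in the generators, so that everything about the syntactic category can be read off in models.

For a formula `φ` in context `x⃗`, let the canonical model `termModel φ` consist of the terms in
`x⃗` modulo `φ`-provable equality. What holds of terms in this model is provable from `φ`
(`provable_of_sat_termModel`). The crux is that `φ` itself holds of `x⃗` there when `φ` is cartesian
(`IsCartesian.sat_termModel`). For `φ = (∃ y) χ` with `y` provably unique, two homomorphisms from
`termModel χ` to a common model that agree on `x⃗` agree on `y`; applied to the characteristic map
of the submodel generated by `x⃗`, this shows that `y` equals a term in `x⃗` (`mem_of_unique`),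
which serves as a witness. Completeness of provability for cartesian hypotheses follows
(`IsCartesian.complete`).

By completeness, a morphism `A → {y : s | ⊤}` of the syntactic category is determined by the values
it takes in models (`SynHom.ext_inducedHom`), and it is of the form `f_{s ≤ p}(x)` for one of the
finitely many variables `x : p` (`exists_map_generator`). Likewise, the morphisms
`θ : A → {y, y' : q | ⊤}` correspond to pairs of elements of `⟨x⃗ | φ⟩` of sort `q`
(`HasComponents`), and `θ` factors through `{y, y' : q | y = y'}` exactly when its components
coincide. Hence the hom-sets occurring in `Mono⟨x⃗ | φ⟩` are finite, and the formula says of `c⃗`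
that elements of `⟨x⃗ | φ⟩` are equal as soon as their images under the homomorphism `x⃗ ↦ c⃗` are. The
existence of diagonals expresses the same injectivity, and the monomorphisms of models are the
injective homomorphisms (`mono_iff_injective`).

On the side of presheaves, subobjects of `F(-, p)` correspond to lower sets of the finite chain
`↓p`, so that `F(-, p)` is a path. Conversely, the elements of a path generate a finite chain of
subpresheaves. If the path has an element, one of largest span generates it, and exhibits it as a
quotient of a representable; the quotient map is invertible because hom-sets of `F` have at most
one element.
-/

namespace ForestLogic

section CanonicalModel

/-! ### Homomorphisms and satisfaction -/

theorem Asg.map_cons {F : Type u} {X Y : F → Type u} (f : ∀ s, X s → Y s) {Γ : Ctx F} {p : F}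
    (a : X p) (ρ : Asg X Γ) :
    (fun s v => f s (Asg.cons a ρ s v)) = Asg.cons (f p a) (fun s v => f s (ρ s v)) := by
  funext s v; cases v <;> rfl

variable {F : Type u} [PartialOrder F]

theorem Str.Hom.map_eval {M N : Str F} (f : Str.Hom M N) {Γ : Ctx F} (ρ : Asg M.carrier Γ) {s : F}
    (t : Term Γ s) : f.toFun s (t.eval M ρ) = t.eval N (fun s v => f.toFun s (ρ s v)) := by
  induction t with
  | var v => rfl
  | app h t ih => simp only [Term.eval, f.map_app, ih]

theorem Fml.Sat.congr {N : Str F} {Γ : Ctx F} {φ : Fml Γ} {ρ ρ' : Asg N.carrier Γ}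
    (h : φ.Sat N ρ) (e : ρ = ρ') : φ.Sat N ρ' :=
  e ▸ h

theorem Fml.sat_sub_cons {N : Str F} {Γ Δ : Ctx F} {s : F} (φ : Fml (s :: Γ)) (t : Term Δ s)
    (σ : Sub Γ Δ) (ρ : Asg N.carrier Δ) :
    (φ.sub (Asg.cons t σ)).Sat N ρ ↔
      φ.Sat N (Asg.cons (t.eval N ρ) fun s v => (σ s v).eval N ρ) := by
  rw [Fml.sat_sub, Asg.map_cons (fun s t => Term.eval N ρ (s := s) t)]

/-- Formulae built from `=, ⊤, ∧, ∃` are preserved by homomorphisms. -/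
theorem Str.Hom.map_sat {M N : Str F} (f : Str.Hom M N) {Γ : Ctx F} {φ : Fml Γ}
    {ρ : Asg M.carrier Γ} (h : φ.Sat M ρ) : φ.Sat N (fun s v => f.toFun s (ρ s v)) := by
  induction φ with
  | eq t t' =>
    change t.eval N _ = t'.eval N _
    rw [← f.map_eval, ← f.map_eval]
    exact congrArg _ h
  | top => trivial
  | and φ ψ ih ih' => exact ⟨ih h.1, ih' h.2⟩
  | ex p φ ih =>
    obtain ⟨a, ha⟩ := h
    exact ⟨f.toFun p a, Asg.map_cons f.toFun a ρ ▸ ih ha⟩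

theorem ModelOf.map_refl (M : ModelOf (presheafTheory F)) {p : F} (a : M.carrier p) :
    M.map (le_refl p) a = a :=
  M.isModel _ (.map_id p) (Asg.cons a Asg.nil) trivial

theorem ModelOf.map_map (M : ModelOf (presheafTheory F)) {p q r : F} (hrq : r ≤ q) (hqp : q ≤ p)
    (a : M.carrier p) : M.map hrq (M.map hqp a) = M.map (hrq.trans hqp) a :=
  M.isModel _ (.map_comp hrq hqp) (Asg.cons a Asg.nil) trivial

/-! ### The canonical model of a formula -/

variable {Γ Δ : Ctx F}

/-- Terms in context `Γ`, identified when `φ` proves them equal. -/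
def termSetoid (φ : Fml Γ) (s : F) : Setoid (Term Γ s) where
  r t t' := Provable (presheafTheory F) φ (.eq t t')
  iseqv :=
    { refl := fun t => (Provable.top_intro _).cut (.eq_refl t)
      symm := Provable.eq_symm
      trans := Provable.eq_trans }

/-- Terms in the variables of the context of `φ`, up to `φ`-provable equality. -/
def termStr (φ : Fml Γ) : Str F where
  carrier s := Quotient (termSetoid φ s)
  map h := Quotient.map (.app h) fun _ _ e => Provable.eq_app h e

/-- The canonical model of a formula-in-context `φ`: its elements are the terms in the variables
of the context, identified when `φ` proves them equal. -/
def termModel (φ : Fml Γ) : ModelOf (presheafTheory F) where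
  toStr := termStr φ
  isModel := by
    rintro S (⟨p⟩ | ⟨hrq, hqp⟩) ρ -
    · change (termStr φ).map (le_refl p) (ρ p .vz) = ρ p .vz
      induction ρ p .vz using Quotient.inductionOn with
      | h t => exact Quotient.sound ((Provable.top_intro _).cut
          (Provable.subst (Asg.cons t Asg.nil) (.ax _ (presheafTheory.map_id p))))
    · rename_i p q r
      change (termStr φ).map hrq ((termStr φ).map hqp (ρ p .vz)) =
        (termStr φ).map (hrq.trans hqp) (ρ p .vz)
      induction ρ p .vz using Quotient.inductionOn with
      | h t => exact Quotient.sound ((Provable.top_intro _).cut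
          (Provable.subst (Asg.cons t Asg.nil) (.ax _ (presheafTheory.map_comp hrq hqp))))

/-- The class of a term in the canonical model. -/
def termClass (φ : Fml Γ) {s : F} (t : Term Γ s) : (termModel φ).carrier s :=
  Quotient.mk _ t

theorem termClass_surjective (φ : Fml Γ) {s : F} (a : (termModel φ).carrier s) :
    ∃ t, termClass φ t = a :=
  Quotient.exists_rep a

theorem termClass_eq_iff {φ : Fml Γ} {s : F} {t t' : Term Γ s} :
    termClass φ t = termClass φ t' ↔ Provable (presheafTheory F) φ (.eq t t') :=
  ⟨fun h => Quotient.exact h, fun h => Quotient.sound (s := termSetoid φ s) h⟩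

theorem eval_termModel (φ : Fml Γ) (σ : Sub Δ Γ) {s : F} (t : Term Δ s) :
    t.eval (termModel φ).toStr (fun s v => termClass φ (σ s v)) = termClass φ (t.sub σ) := by
  induction t with
  | var v => rfl
  | app h t ih => simp only [Term.eval, Term.sub, ih]; rfl

/-- Whatever holds of a tuple of terms in the canonical model of `φ` is provable from `φ`. -/
theorem provable_of_sat_termModel {φ : Fml Γ} (χ : Fml Δ) (σ : Sub Δ Γ)
    (h : χ.Sat (termModel φ).toStr (fun s v => termClass φ (σ s v))) :
    Provable (presheafTheory F) φ (χ.sub σ) := by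
  induction χ with
  | eq t t' =>
    change t.eval _ _ = t'.eval _ _ at h
    rw [eval_termModel, eval_termModel] at h
    exact termClass_eq_iff.1 h
  | top => exact .top_intro _
  | and χ ξ ih ih' => exact .and_intro (ih σ h.1) (ih' σ h.2)
  | ex p χ ih =>
    obtain ⟨a, ha⟩ := h
    obtain ⟨t, rfl⟩ := termClass_surjective φ a
    rw [← Asg.map_cons (fun s => termClass φ (s := s))] at ha
    refine .ex_wit t ?_
    rw [Fml.sub_sub]
    convert ih _ ha using 2
    rw [Sub.lift, Sub.comp_cons, Sub.comp_assoc]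
    congr 1
    funext s v
    exact Term.sub_id _

/-- Substitution as a homomorphism between canonical models. -/
def termModelMap {φ : Fml Γ} {ψ : Fml Δ} (σ : Sub Γ Δ)
    (h : Provable (presheafTheory F) ψ (φ.sub σ)) :
    Str.Hom (termModel φ).toStr (termModel ψ).toStr where
  toFun s := Quotient.map (fun t => t.sub σ) fun _ _ e => h.cut (.subst σ e)
  map_app := by
    intro p q hq a
    induction a using Quotient.inductionOn with
    | h t => rfl

theorem sat_termModel_map {φ : Fml Γ} {ψ : Fml Δ} (σ : Sub Γ Δ)
    (h : Provable (presheafTheory F) ψ (φ.sub σ))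
    (hφ : φ.Sat (termModel φ).toStr (fun _ v => termClass φ (.var v))) :
    φ.Sat (termModel ψ).toStr (fun s v => termClass ψ (σ s v)) :=
  (termModelMap σ h).map_sat hφ

variable (F) in
/-- The model whose elements of sort `q` are the sets of elements below `q`, with restriction as the
action; the sets need not be downward closed. Homomorphisms `M → sieveModel F` can tell a submodel
of `M` apart from the whole of `M`. -/
def sieveModel : ModelOf (presheafTheory F) where
  carrier q := ∀ r, r ≤ q → Prop
  map h a r hr := a r (hr.trans h)
  isModel := by
    rintro S (⟨p⟩ | ⟨hrq, hqp⟩) ρ - <;> rfl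

/-- The homomorphism sending `a` to the set of those `r` for which the restriction of `a` to `r`
satisfies `S`. -/
def sieveHom (M : ModelOf (presheafTheory F)) (S : ∀ s, M.carrier s → Prop) :
    Str.Hom M.toStr (sieveModel F).toStr where
  toFun q a r hr := S r (M.map hr a)
  map_app h a := by
    funext r hr
    rw [M.map_map]
    rfl

/-- If at most one `y` satisfies `χ(y, x⃗)` provably, then any `y` satisfying it in a model lies
in every submodel containing `x⃗`: the characteristic map of the submodel and the constant map
agree on `x⃗`, hence on `y`. -/
theorem mem_of_unique {p : F} {χ : Fml (p :: Γ)}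
    (hu : Provable (presheafTheory F)
      (.and (χ.sub (Asg.cons (.var .vz) (fun _ v => .var (.vs (.vs v)))))
        (χ.sub (Sub.wk (p :: Γ) p)))
      (.eq (.var .vz : Term (p :: p :: Γ) p) (.var (.vs .vz))))
    (M : ModelOf (presheafTheory F)) (S : ∀ s, M.carrier s → Prop)
    (hS : ∀ {p q : F} (h : q ≤ p) (a : M.carrier p), S p a → S q (M.map h a))
    {y : M.carrier p} {ρ : Asg M.carrier Γ} (hρ : ∀ s v, S s (ρ s v))
    (hy : χ.Sat M.toStr (Asg.cons y ρ)) : S p y := by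
  have h1 := (sieveHom M S).map_sat hy
  have h2 := (sieveHom M fun _ _ => True).map_sat hy
  rw [Asg.map_cons] at h1 h2
  have e : (fun s v => (sieveHom M S).toFun s (ρ s v)) =
      fun s v => (sieveHom M fun _ _ => True).toFun s (ρ s v) := by
    funext s v r hr
    exact eq_true (hS hr _ (hρ s v))
  rw [← e] at h2
  have h3 := hu.sound (sieveModel F).isModel
    (Asg.cons ((sieveHom M S).toFun p y) (Asg.cons ((sieveHom M fun _ _ => True).toFun p y)
      (fun s v => (sieveHom M S).toFun s (ρ s v)))) ⟨by
        rw [Fml.sat_sub]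
        convert h1 using 1
        funext s v; cases v <;> rfl, by
        rw [Fml.sat_sub]
        exact h2⟩
  have h4 : S p (M.map (le_refl p) y) = True := congrFun (congrFun h3 p) (le_refl p)
  rw [M.map_refl] at h4
  exact of_eq_true h4

/-- A cartesian formula holds of the variables in its canonical model. A provably unique witness
must be equal to a term in the free variables, as the terms in the free variables form a submodel;
hence the existential quantifier can be instantiated with that term. -/
theorem IsCartesian.sat_termModel {φ : Fml Γ} (h : IsCartesian (presheafTheory F) φ) :
    φ.Sat (termModel φ).toStr (fun _ v => termClass φ (.var v)) := by
  induction h with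
  | @eq Γ s t t' =>
    change t.eval _ (fun s v => termClass _ (Sub.id Γ s v)) =
      t'.eval _ (fun s v => termClass _ (Sub.id Γ s v))
    rw [eval_termModel, eval_termModel, Term.sub_id, Term.sub_id]
    exact termClass_eq_iff.2 (.ident _)
  | top => trivial
  | @and Γ φ ψ _ _ ih ih' =>
    refine ⟨sat_termModel_map (Sub.id Γ) ?_ ih, sat_termModel_map (Sub.id Γ) ?_ ih'⟩
    · rw [Fml.sub_id]; exact .and_left _ _
    · rw [Fml.sub_id]; exact .and_right _ _
  | @ex Γ p χ hχ hu ih =>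
    have ih' := ih
    rw [← Asg.cons_eta (fun s v => termClass χ (.var v))] at ih
    obtain ⟨t, ht⟩ := mem_of_unique hu (termModel χ)
      (fun s a => ∃ t : Term Γ s, termClass χ (t.sub (Sub.wk Γ p)) = a)
      (by rintro q r h _ ⟨t, rfl⟩; exact ⟨.app h t, rfl⟩) (fun s v => ⟨.var v, rfl⟩) ih
    -- rewriting `y` to `t` in `χ(y, x⃗)`
    have h1 : Provable (presheafTheory F) χ ((χ.sub (Sub.inst t)).sub (Sub.wk Γ p)) := by
      have := Provable.rewrite (χ.sub (Asg.cons (.var .vz) fun _ v => .var (.vs (.vs v))))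
        (termClass_eq_iff.1 ht).eq_symm (χ := χ)
      rw [Fml.sub_cons_sub, Fml.sub_cons_sub] at this
      rw [Sub.inst, Fml.sub_cons_sub]
      refine this ?_
      change Provable _ _ (χ.sub (Asg.cons (.var .vz) fun _ v => .var (.vs v)))
      rw [← Sub.id_eq, Fml.sub_id]
      exact .ident _
    -- `χ(t, x⃗)` holds in the canonical model of `(∃ y) χ`, being the image of `χ(y, x⃗)` under
    -- `y ↦ t`
    refine ⟨termClass _ t, ?_⟩
    have := sat_termModel_map (Sub.inst t) (.ex_elim h1) ih'
    rw [Sub.inst, Asg.map_cons (fun s => termClass (Fml.ex p χ) (s := s))] at this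
    exact this

/-- Completeness: whatever follows from a cartesian formula in all models is provable. -/
theorem IsCartesian.complete {φ χ : Fml Γ} (hφ : IsCartesian (presheafTheory F) φ)
    (h : ∀ (M : ModelOf (presheafTheory F)) (ρ : Asg M.carrier Γ),
      φ.Sat M.toStr ρ → χ.Sat M.toStr ρ) :
    Provable (presheafTheory F) φ χ := by
  have := provable_of_sat_termModel χ (Sub.id Γ) (h _ _ hφ.sat_termModel)
  rwa [Fml.sub_id] at this

end CanonicalModel

section Presentation

/-! ### Elements of presented models -/

theorem Var.mem {F : Type u} {Γ : Ctx F} {s : F} (v : Var Γ s) : s ∈ Γ := by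
  induction v with
  | vz => exact List.mem_cons_self
  | vs v ih => exact List.mem_cons_of_mem _ ih

theorem Var.finite_sigma {F : Type u} (Γ : Ctx F) : Finite (Σ s, Var Γ s) := by
  induction Γ with
  | nil => exact @Finite.of_fintype _ (@Fintype.ofIsEmpty _ ⟨fun x => nomatch x.2⟩)
  | cons p Γ ih =>
    refine Finite.of_surjective
      (fun o : Option (Σ s, Var Γ s) => o.elim ⟨p, .vz⟩ fun x => ⟨x.1, .vs x.2⟩) ?_
    rintro ⟨s, v⟩
    cases v with
    | vz => exact ⟨none, rfl⟩
    | vs v => exact ⟨some ⟨s, v⟩, rfl⟩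

variable {F : Type u} [PartialOrder F]

/-- Every term is provably of the form `f_{s ≤ p}(x)` for a variable `x : p`. -/
theorem Term.exists_eval_eq {Γ : Ctx F} {s : F} (t : Term Γ s) :
    ∃ (p : F) (v : Var Γ p) (h : s ≤ p), ∀ (M : ModelOf (presheafTheory F))
      (c : Asg M.carrier Γ), t.eval M.toStr c = M.map h (c p v) := by
  induction t with
  | var v => exact ⟨_, v, le_refl _, fun M c => (M.map_refl _).symm⟩
  | app h t ih =>
    obtain ⟨p, v, h', e⟩ := ih
    exact ⟨p, v, h.trans h', fun M c => by rw [Term.eval, e, M.map_map]⟩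

variable {A : SynObj (presheafTheory F)} {M : ModelOf (presheafTheory F)}

theorem inducedHom_sat (c : Asg M.carrier A.ctx) (hc : A.fml.Sat M.toStr c) {s : F}
    (a : SynHom A (SynObj.free (presheafTheory F) [s])) :
    a.fml.Sat M.toStr (Asg.cons ((inducedHom c hc).toFun s a) c : Asg M.carrier (s :: A.ctx)) :=
  (a.isFun.existsUnique M.isModel c hc).choose_spec.1

/-- The value of the homomorphism induced by `c⃗` at the class of `a(x⃗, y)` is the element `b` such
that `a(c⃗, b)`. -/
theorem inducedHom_eq {c : Asg M.carrier A.ctx} {hc : A.fml.Sat M.toStr c} {s : F}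
    {a : SynHom A (SynObj.free (presheafTheory F) [s])} {b : M.carrier s}
    (h : a.fml.Sat M.toStr (Asg.cons b c : Asg M.carrier (s :: A.ctx))) :
    (inducedHom c hc).toFun s a = b :=
  ((a.isFun.existsUnique M.isModel c hc).choose_spec.2 b h).symm

theorem SynHom.fml_mk {T : Set (Sequent F)} {A B : SynObj T} (θ : FunRel A B) :
    Provable T (SynHom.fml (Quotient.mk (FunRel.setoid A B) θ)) θ.fml ∧
      Provable T θ.fml (SynHom.fml (Quotient.mk (FunRel.setoid A B) θ)) :=
  Quotient.exact (Quotient.out_eq (Quotient.mk (FunRel.setoid A B) θ))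

theorem SynHom.eq_of_provable {T : Set (Sequent F)} {A B : SynObj T} {θ θ' : SynHom A B}
    (h : Provable T θ.fml θ'.fml) (h' : Provable T θ'.fml θ.fml) : θ = θ' := by
  rw [← Quotient.out_eq θ, ← Quotient.out_eq θ']
  exact Quotient.sound ⟨h, h'⟩

theorem inducedHom_generator (c : Asg M.carrier A.ctx) (hc : A.fml.Sat M.toStr c) {s : F}
    (v : Var A.ctx s) : (inducedHom c hc).toFun s (generator A s v) = c s v := by
  refine inducedHom_eq ((SynHom.fml_mk _).2.sound M.isModel _
    ⟨(Fml.sat_sub M.toStr (Sub.wk A.ctx s) (Asg.cons (c s v) c) A.fml).2 hc, rfl⟩)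

/-- Elements of `⟨x⃗ | φ⟩` are equal if they name the same element in every model of `φ`. -/
theorem SynHom.ext_inducedHom {s : F} {a b : SynHom A (SynObj.free (presheafTheory F) [s])}
    (h : ∀ (M : ModelOf (presheafTheory F)) (c : Asg M.carrier A.ctx) (hc : A.fml.Sat M.toStr c),
      (inducedHom c hc).toFun s a = (inducedHom c hc).toFun s b) : a = b := by
  have key : ∀ {a b : SynHom A (SynObj.free (presheafTheory F) [s])},
      (∀ (M : ModelOf (presheafTheory F)) (c : Asg M.carrier A.ctx) (hc : A.fml.Sat M.toStr c),
        (inducedHom c hc).toFun s a = (inducedHom c hc).toFun s b) →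
      Provable (presheafTheory F) a.fml b.fml := by
    intro a b h
    refine IsCartesian.complete (Γ := s :: A.ctx) a.isFun.cartesian fun M ρ hρ => ?_
    have hc : A.fml.Sat M.toStr (fun s v => ρ s (.vs v)) :=
      (Fml.sat_sub _ _ _ _).1 (a.isFun.le.sound M.isModel ρ hρ)
    rw [← Asg.cons_eta ρ] at hρ ⊢
    rw [← inducedHom_eq (hc := hc) hρ, h]
    exact inducedHom_sat _ hc b
  exact SynHom.eq_of_provable (key h) (key fun M c hc => (h M c hc).symm)

theorem inducedHom_eval (c : Asg M.carrier A.ctx) (hc : A.fml.Sat M.toStr c) {s : F}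
    (t : Term A.ctx s) :
    (inducedHom c hc).toFun s (t.eval (presentedStr A) (generator A)) = t.eval M.toStr c := by
  refine ((inducedHom c hc).map_eval (generator A) t).trans ?_
  congr 1
  funext s v
  exact inducedHom_generator c hc v

/-- The generators generate `⟨x⃗ | φ⟩`: the value of an element in the canonical model of `φ` is the
class of a term, which names the element. -/
theorem exists_eval_generator {s : F} (a : SynHom A (SynObj.free (presheafTheory F) [s])) :
    ∃ t : Term A.ctx s, t.eval (presentedStr A) (generator A) = a := by
  obtain ⟨b, hb⟩ := a.isFun.total.sound (termModel A.fml).isModel _ A.cartesian.sat_termModel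
  obtain ⟨t, rfl⟩ := termClass_surjective _ b
  have h := provable_of_sat_termModel (Δ := s :: A.ctx) (φ := A.fml) a.fml
    (Asg.cons t (Sub.id A.ctx)) (by rw [Asg.map_cons (fun s => termClass A.fml (s := s))]; exact hb)
  refine ⟨t, SynHom.ext_inducedHom fun M c hc => ?_⟩
  rw [inducedHom_eval]
  refine (inducedHom_eq ?_).symm
  have := (Fml.sat_sub (Γ := s :: A.ctx) _ _ _ _).1 (h.sound M.isModel c hc)
  rw [Asg.map_cons (fun s t => Term.eval M.toStr c (s := s) t)] at this
  exact this

theorem exists_map_generator {s : F} (a : SynHom A (SynObj.free (presheafTheory F) [s])) :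
    ∃ (p : F) (v : Var A.ctx p) (h : s ≤ p), (presented A).map h (generator A p v) = a := by
  obtain ⟨t, rfl⟩ := exists_eval_generator a
  obtain ⟨p, v, h, e⟩ := t.exists_eval_eq
  exact ⟨p, v, h, (e (presented A) (generator A)).symm⟩

theorem presented_hom_ext {f g : presented A ⟶ M}
    (h : ∀ s v, f.toFun s (generator A s v) = g.toFun s (generator A s v)) : f = g := by
  refine Str.Hom.ext ?_
  funext s a
  obtain ⟨p, v, hp, rfl⟩ := exists_map_generator a
  exact (f.map_app hp (generator A p v)).trans
    ((congrArg (M.map hp) (h p v)).trans (g.map_app hp (generator A p v)).symm)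

instance finite_synHom (A : SynObj (presheafTheory F)) (s : F) :
    Finite (SynHom A (SynObj.free (presheafTheory F) [s])) := by
  have := Var.finite_sigma A.ctx
  refine Finite.of_surjective
    (fun x : {x : Σ p, Var A.ctx p // s ≤ x.1} =>
      ((presented A).map x.2 (generator A x.1.1 x.1.2) :
        SynHom A (SynObj.free (presheafTheory F) [s]))) fun a => ?_
  obtain ⟨p, v, h, e⟩ := exists_map_generator a
  exact ⟨⟨⟨p, v⟩, h⟩, e⟩

theorem generator_diag (q : F) :
    generator (SynObj.diag (presheafTheory F) q) q .vz =
      generator (SynObj.diag (presheafTheory F) q) q (.vs .vz) := by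
  refine SynHom.ext_inducedHom fun M c hc => ?_
  exact (inducedHom_generator c hc .vz).trans
    (Eq.trans hc (inducedHom_generator c hc (.vs .vz)).symm)

theorem mono_iff_injective {N M : ModelOf (presheafTheory F)} (h : N ⟶ M) :
    Mono h ↔ ∀ s, Function.Injective (h.toFun s) := by
  constructor
  · intro _ s a b hab
    -- an element of sort `s` is a homomorphism from `⟨x : s | ⊤⟩`
    let f (a : N.carrier s) : presented (SynObj.free (presheafTheory F) [s]) ⟶ N :=
      inducedHom (A := SynObj.free (presheafTheory F) [s]) (Asg.cons a Asg.nil) trivial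
    have hf (a : N.carrier s) : (f a).toFun s (generator _ s .vz) = a :=
      inducedHom_generator (A := SynObj.free (presheafTheory F) [s]) (Asg.cons a Asg.nil) trivial
        .vz
    have : f a = f b := by
      rw [← cancel_mono h]
      refine presented_hom_ext fun s' v => ?_
      cases v with
      | vz =>
        change h.toFun s ((f a).toFun s _) = h.toFun s ((f b).toFun s _)
        rw [hf, hf, hab]
      | vs v => nomatch v
    rw [← hf a, this, hf]
  · intro hi
    refine ⟨fun f g e => Str.Hom.ext ?_⟩
    funext s a
    exact hi s (congrFun (congrFun (congrArg Str.Hom.toFun e) s) a)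

end Presentation

section MonoFormula

variable {F : Type u} [PartialOrder F] {A : SynObj (presheafTheory F)}
  {M : ModelOf (presheafTheory F)} {q : F}

/-! ### Pairs of elements as morphisms of the syntactic category -/

theorem FunRel.sat_dom (θ : FunRel A (SynObj.free (presheafTheory F) [q, q])) {b b' : M.carrier q}
    {c : Asg M.carrier A.ctx}
    (h : θ.fml.Sat M.toStr (Asg.cons b (Asg.cons b' c) : Asg M.carrier (q :: q :: A.ctx))) :
    A.fml.Sat M.toStr c :=
  (Fml.sat_sub M.toStr (Δ := q :: q :: A.ctx) _ _ A.fml).1 (θ.le.sound M.isModel _ h).1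

theorem FunRel.sat_unique (θ : FunRel A (SynObj.free (presheafTheory F) [q, q]))
    {b b' d d' : M.carrier q} {c : Asg M.carrier A.ctx}
    (h : θ.fml.Sat M.toStr (Asg.cons b (Asg.cons b' c) : Asg M.carrier (q :: q :: A.ctx)))
    (h' : θ.fml.Sat M.toStr (Asg.cons d (Asg.cons d' c) : Asg M.carrier (q :: q :: A.ctx))) :
    b = d ∧ b' = d' := by
  have := θ.unique.sound M.isModel
    (Asg.cons b (Asg.cons b' (Asg.cons d (Asg.cons d' c))) :
      Asg M.carrier (q :: q :: q :: q :: A.ctx)) ⟨by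
        refine (Fml.sat_sub (Γ := q :: q :: A.ctx) _ _ _ _).2 (h.congr (Γ := q :: q :: A.ctx) ?_)
        funext s v
        rcases v with _ | _ | _ <;> rfl,
      (Fml.sat_sub (Γ := q :: q :: A.ctx) _ _ _ _).2 h'⟩
  exact ⟨this.1, this.2.1⟩

/-- The morphism `θ : A → {y, y' : q | ⊤}` has the components `a` and `a'`. -/
def HasComponents (θ : SynHom A (SynObj.free (presheafTheory F) [q, q]))
    (a a' : SynHom A (SynObj.free (presheafTheory F) [q])) : Prop :=
  ∀ (M : ModelOf (presheafTheory F)) (c : Asg M.carrier A.ctx) (hc : A.fml.Sat M.toStr c),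
    θ.fml.Sat M.toStr (Asg.cons ((inducedHom c hc).toFun q a)
      (Asg.cons ((inducedHom c hc).toFun q a') c) : Asg M.carrier (q :: q :: A.ctx))

theorem HasComponents.eq_of_sat {θ : SynHom A (SynObj.free (presheafTheory F) [q, q])}
    {a a' : SynHom A (SynObj.free (presheafTheory F) [q])} (h : HasComponents θ a a')
    {c : Asg M.carrier A.ctx} (hc : A.fml.Sat M.toStr c) {b b' : M.carrier q}
    (hb : θ.fml.Sat M.toStr (Asg.cons b (Asg.cons b' c) : Asg M.carrier (q :: q :: A.ctx))) :
    (inducedHom c hc).toFun q a = b ∧ (inducedHom c hc).toFun q a' = b' :=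
  θ.out.sat_unique (h M c hc) hb

/-- The values of `θ` in the canonical model of `φ` are classes of terms, which name its
components. -/
theorem exists_hasComponents (θ : SynHom A (SynObj.free (presheafTheory F) [q, q])) :
    ∃ a a', HasComponents θ a a' := by
  obtain ⟨b', b, hb⟩ :=
    θ.out.total.sound (termModel A.fml).isModel _ A.cartesian.sat_termModel
  obtain ⟨t, rfl⟩ := termClass_surjective _ b
  obtain ⟨t', rfl⟩ := termClass_surjective _ b'
  have h := provable_of_sat_termModel (Δ := q :: q :: A.ctx) (φ := A.fml) θ.fml
    (Asg.cons t (Asg.cons t' (Sub.id A.ctx))) (by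
      rw [Asg.map_cons (fun s => termClass A.fml (s := s)),
        Asg.map_cons (fun s => termClass A.fml (s := s))]
      exact hb)
  refine ⟨t.eval (presentedStr A) (generator A), t'.eval (presentedStr A) (generator A),
    fun M c hc => ?_⟩
  have := (Fml.sat_sub (Γ := q :: q :: A.ctx) _ _ _ _).1 (h.sound M.isModel c hc)
  rw [Asg.map_cons (fun s t => Term.eval M.toStr c (s := s) t),
    Asg.map_cons (fun s t => Term.eval M.toStr c (s := s) t)] at this
  rw [inducedHom_eval, inducedHom_eval]
  exact this

theorem HasComponents.unique {θ θ' : SynHom A (SynObj.free (presheafTheory F) [q, q])}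
    {a a' : SynHom A (SynObj.free (presheafTheory F) [q])} (h : HasComponents θ a a')
    (h' : HasComponents θ' a a') : θ = θ' := by
  have key : ∀ {θ θ' : SynHom A (SynObj.free (presheafTheory F) [q, q])},
      HasComponents θ a a' → HasComponents θ' a a' →
      Provable (presheafTheory F) θ.fml θ'.fml := by
    intro θ θ' h h'
    refine IsCartesian.complete (Γ := q :: q :: A.ctx) θ.out.cartesian fun M ρ hρ => ?_
    rw [← Asg.cons_eta ρ, ← Asg.cons_eta (fun s v => ρ s (.vs v))] at hρ ⊢
    have hc := θ.out.sat_dom hρ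
    obtain ⟨e, e'⟩ := h.eq_of_sat hc hρ
    have := h' M _ hc
    rwa [e, e'] at this
  exact SynHom.eq_of_provable (key h h') (key h' h)

instance finite_synHom_pair (A : SynObj (presheafTheory F)) (q : F) :
    Finite (SynHom A (SynObj.free (presheafTheory F) [q, q])) := by
  choose f f' hf using fun θ : SynHom A (SynObj.free (presheafTheory F) [q, q]) =>
    exists_hasComponents θ
  refine Finite.of_injective (fun θ => (f θ, f' θ)) fun θ θ' e => ?_
  have h := hf θ'
  rw [← show f θ = f θ' from congrArg Prod.fst e,
    ← show f' θ = f' θ' from congrArg Prod.snd e] at h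
  exact (hf θ).unique h

/-- The inclusion `{y, y' : q | y = y'} → {y, y' : q | ⊤}` is a monomorphism, as composition with it
does not change the formula. -/
theorem SynHom.toFree_injective : Function.Injective
    (SynHom.toFree : SynHom A (SynObj.diag (presheafTheory F) q) → _) := by
  intro δ δ' e
  induction δ using Quotient.inductionOn with
  | h δ =>
    induction δ' using Quotient.inductionOn with
    | h δ' => exact Quotient.sound (s := FunRel.setoid A _) (Quotient.exact
        (s := FunRel.setoid A (SynObj.free _ [q, q])) e)

/-- The graph `a(x⃗, y) ∧ a'(x⃗, y')` of the pairing of two elements. -/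
noncomputable def pairFml (a a' : SynHom A (SynObj.free (presheafTheory F) [q])) :
    Fml (q :: q :: A.ctx) :=
  .and (Fml.sub (Γ := q :: A.ctx) (Asg.cons (.var .vz) fun _ v => .var (.vs (.vs v))) a.fml)
    (Fml.sub (Γ := q :: A.ctx) (Asg.cons (.var (.vs .vz)) fun _ v => .var (.vs (.vs v))) a'.fml)

theorem sat_pairFml (a a' : SynHom A (SynObj.free (presheafTheory F) [q]))
    (ρ : Asg M.carrier (q :: q :: A.ctx)) :
    (pairFml a a').Sat M.toStr ρ ↔
      ∃ hc : A.fml.Sat M.toStr (fun s v => ρ s (.vs (.vs v))),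
        (inducedHom _ hc).toFun q a = ρ q .vz ∧ (inducedHom _ hc).toFun q a' = ρ q (.vs .vz) := by
  refine (and_congr (Fml.sat_sub_cons (Γ := A.ctx) a.fml _ _ _)
    (Fml.sat_sub_cons (Γ := A.ctx) a'.fml _ _ _)).trans ?_
  constructor
  · rintro ⟨h, h'⟩
    have hc : A.fml.Sat M.toStr (fun s v => ρ s (.vs (.vs v))) :=
      (Fml.sat_sub M.toStr (Sub.wk A.ctx q) _ A.fml).1 (a.isFun.le.sound M.isModel _ h)
    exact ⟨hc, inducedHom_eq h, inducedHom_eq h'⟩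
  · rintro ⟨hc, h, h'⟩
    exact ⟨(inducedHom_sat _ hc a).congr (Γ := q :: A.ctx) (congrArg (Asg.cons · _) h),
      (inducedHom_sat _ hc a').congr (Γ := q :: A.ctx) (congrArg (Asg.cons · _) h')⟩

theorem isCartesian_pairFml (a a' : SynHom A (SynObj.free (presheafTheory F) [q])) :
    IsCartesian (presheafTheory F) (pairFml a a') :=
  .and (.sub (Γ := q :: A.ctx) a.isFun.cartesian _) (.sub (Γ := q :: A.ctx) a'.isFun.cartesian _)

/-- The pairing of two elements, as a functional relation. -/
noncomputable def pairRel (a a' : SynHom A (SynObj.free (presheafTheory F) [q])) :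
    FunRel A (SynObj.free (presheafTheory F) [q, q]) where
  fml := pairFml a a'
  cartesian := isCartesian_pairFml a a'
  le := (isCartesian_pairFml a a').complete fun M ρ hρ =>
    ⟨(Fml.sat_sub M.toStr (Δ := q :: q :: A.ctx) _ _ A.fml).2 ((sat_pairFml a a' ρ).1 hρ).1,
      trivial⟩
  unique := by
    refine IsCartesian.complete (Γ := q :: q :: q :: q :: A.ctx)
      (.and (.sub (Γ := q :: q :: A.ctx) (isCartesian_pairFml a a') _)
        (.sub (Γ := q :: q :: A.ctx) (isCartesian_pairFml a a') _)) fun M ρ hρ => ?_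
    obtain ⟨_, h, h'⟩ := (sat_pairFml a a' _).1
      ((Fml.sat_sub (Γ := q :: q :: A.ctx) _ _ _ _).1 hρ.1)
    obtain ⟨_, k, k'⟩ := (sat_pairFml a a' _).1
      ((Fml.sat_sub (Γ := q :: q :: A.ctx) _ _ _ _).1 hρ.2)
    exact ⟨h.symm.trans k, h'.symm.trans k', trivial⟩
  total := A.cartesian.complete fun M c hc =>
    ⟨(inducedHom c hc).toFun q a', (inducedHom c hc).toFun q a,
      (sat_pairFml a a' (Asg.cons _ (Asg.cons _ c))).2 ⟨hc, rfl, rfl⟩⟩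

theorem exists_pair (a a' : SynHom A (SynObj.free (presheafTheory F) [q])) :
    ∃ θ, HasComponents θ a a' :=
  ⟨Quotient.mk _ (pairRel a a'), fun M c hc => (SynHom.fml_mk _).2.sound M.isModel _
    ((sat_pairFml a a' (Asg.cons ((inducedHom c hc).toFun q a)
      (Asg.cons ((inducedHom c hc).toFun q a') c))).2 ⟨hc, rfl, rfl⟩)⟩

/-- A morphism to `{y, y' : q | ⊤}` factors through `{y, y' : q | y = y'}` if and only if its
components are equal. -/
theorem HasComponents.exists_toFree_iff {θ : SynHom A (SynObj.free (presheafTheory F) [q, q])}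
    {a a' : SynHom A (SynObj.free (presheafTheory F) [q])} (h : HasComponents θ a a') :
    (∃ δ : SynHom A (SynObj.diag (presheafTheory F) q), δ.toFree = θ) ↔ a = a' := by
  constructor
  · rintro ⟨δ, rfl⟩
    refine SynHom.ext_inducedHom fun M c hc => ?_
    induction δ using Quotient.inductionOn with
    | h δ =>
      have h1 := (SynHom.fml_mk (FunRel.toFree δ)).1.sound M.isModel _ (h M c hc)
      exact (Fml.sat_sub M.toStr (Γ := [q, q]) (Δ := q :: q :: A.ctx) _ _ _).1
        (δ.le.sound M.isModel _ h1).2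
  · rintro rfl
    refine ⟨Quotient.mk _ ⟨θ.fml, θ.out.cartesian, ?_, θ.out.unique, θ.out.total⟩,
      (Quotient.out_eq θ)⟩
    refine IsCartesian.complete (Γ := q :: q :: A.ctx) θ.out.cartesian fun M ρ hρ => ?_
    refine ⟨(θ.out.le.sound M.isModel _ hρ).1,
      (Fml.sat_sub M.toStr (Γ := [q, q]) (Δ := q :: q :: A.ctx) _ _ _).2 ?_⟩
    rw [← Asg.cons_eta ρ, ← Asg.cons_eta (fun s v => ρ s (.vs v))] at hρ
    obtain ⟨e, e'⟩ := h.eq_of_sat (θ.out.sat_dom hρ) hρ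
    exact e.symm.trans e'

theorem SynHom.fml_toFree (δ : SynHom A (SynObj.diag (presheafTheory F) q)) :
    Provable (presheafTheory F) δ.toFree.fml δ.fml ∧
      Provable (presheafTheory F) δ.fml δ.toFree.fml := by
  have := SynHom.fml_mk (FunRel.toFree δ.out)
  rwa [← show δ.toFree = Quotient.mk _ (FunRel.toFree δ.out) from
    (congrArg SynHom.toFree (Quotient.out_eq δ)).symm] at this

/-! ### The formula defining monomorphisms -/

theorem Fml.isFinite_toLFml {Γ : Ctx F} (φ : Fml Γ) : φ.toLFml.IsFinite := by
  induction φ with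
  | eq t t' => trivial
  | top => exact ⟨inferInstance, fun i => nomatch i⟩
  | and φ ψ ih ih' =>
    refine ⟨inferInstance, fun b => ?_⟩
    rcases b with ⟨_ | _⟩
    · exact ih'
    · exact ih
  | ex p φ ih => exact ih

theorem LFml.sat_and {N : Str F} {Γ : Ctx F} (φ ψ : LFml Γ) (ρ : Asg N.carrier Γ) :
    (φ.and ψ).Sat N ρ ↔ φ.Sat N ρ ∧ ψ.Sat N ρ :=
  ⟨fun h => ⟨h ⟨true⟩, h ⟨false⟩⟩, fun h b => by
    rcases b with ⟨_ | _⟩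
    · exact h.2
    · exact h.1⟩

theorem LFml.sat_imp {N : Str F} {Γ : Ctx F} (φ ψ : LFml Γ) (ρ : Asg N.carrier Γ) :
    (φ.imp ψ).Sat N ρ ↔ (φ.Sat N ρ → ψ.Sat N ρ) := by
  constructor
  · rintro ⟨⟨_ | _⟩, h⟩ hφ
    · exact h
    · exact absurd hφ h
  · intro h
    by_cases hφ : φ.Sat N ρ
    · exact ⟨⟨false⟩, h hφ⟩
    · exact ⟨⟨true⟩, hφ⟩

theorem Fml.sat_toLFml {N : Str F} {Γ : Ctx F} (φ : Fml Γ) (ρ : Asg N.carrier Γ) :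
    φ.toLFml.Sat N ρ ↔ φ.Sat N ρ := by
  induction φ with
  | eq t t' => rfl
  | top => exact ⟨fun _ => trivial, fun _ i => nomatch i⟩
  | and φ ψ ih ih' => exact (LFml.sat_and _ _ _).trans (and_congr (ih ρ) (ih' ρ))
  | ex p φ ih => exact exists_congr fun a => ih _

theorem isFinite_monoFormula (hF : IsForest F) (A : SynObj (presheafTheory F)) :
    (monoFormula A).IsFinite := by
  refine ⟨?_, fun q => ⟨finite_synHom_pair A q.1, fun θ => ⟨inferInstance, fun b => ?_⟩⟩⟩
  · refine Set.Finite.to_subtype (s := {q : F | ∃ p ∈ A.ctx, q ≤ p}) ?_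
    exact ((List.finite_toSet A.ctx).biUnion fun p _ => (hF p).1).subset
      fun q ⟨p, hp, hq⟩ => Set.mem_biUnion (x := p) hp hq
  · rcases b with ⟨_ | _⟩
    · have : Subsingleton {δ : SynHom A (SynObj.diag (presheafTheory F) q.1) // δ.toFree = θ} :=
        ⟨fun δ δ' => Subtype.ext (SynHom.toFree_injective (δ.2.trans δ'.2.symm))⟩
      exact ⟨inferInstance, fun δ => Fml.isFinite_toLFml (Γ := q.1 :: q.1 :: A.ctx) _⟩
    · refine ⟨inferInstance, fun b => ?_⟩
      rcases b with ⟨_ | _⟩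
      · exact Fml.isFinite_toLFml (Γ := q.1 :: q.1 :: A.ctx) _
      · trivial

/-- As `δ` and `ι ∘ δ` have equivalent formulas, `δ(x⃗, y, y')` need not be mentioned in the
conclusion of `Mono⟨x⃗ | φ⟩`. -/
theorem sat_monoFormula (c : Asg M.carrier A.ctx) :
    (monoFormula A).Sat M.toStr c ↔
      ∀ q : F, (∃ p ∈ A.ctx, q ≤ p) →
        ∀ (θ : SynHom A (SynObj.free (presheafTheory F) [q, q])) (b : M.carrier q),
          θ.fml.Sat M.toStr (Asg.cons b (Asg.cons b c) : Asg M.carrier (q :: q :: A.ctx)) →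
            ∃ δ : SynHom A (SynObj.diag (presheafTheory F) q), δ.toFree = θ := by
  constructor
  · intro h q hq θ b hb
    obtain ⟨δ, -⟩ := (LFml.sat_imp _ _ _).1 (h ⟨q, hq⟩ θ b b)
      ((LFml.sat_and _ _ _).2 ⟨rfl, (Fml.sat_toLFml (Γ := q :: q :: A.ctx) _ _).2 hb⟩)
    exact ⟨δ.1, δ.2⟩
  · intro h q θ b' b
    refine (LFml.sat_imp _ _ _).2 fun hb => ?_
    obtain ⟨e, hb⟩ := (LFml.sat_and _ _ _).1 hb
    have hb := (Fml.sat_toLFml (Γ := q.1 :: q.1 :: A.ctx) _ _).1 hb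
    obtain rfl : b = b' := e
    obtain ⟨δ, rfl⟩ := h q.1 q.2 θ b hb
    exact ⟨⟨δ, rfl⟩, (Fml.sat_toLFml (Γ := q.1 :: q.1 :: A.ctx) _ _).2
      (δ.fml_toFree.1.sound M.isModel _ hb)⟩

/-- Sorts that are not below a sort of the context are empty in `⟨x⃗ | φ⟩`, so that the formula
need not mention them. -/
theorem exists_mem_ctx_of_synHom {s : F} (a : SynHom A (SynObj.free (presheafTheory F) [s])) :
    ∃ p ∈ A.ctx, s ≤ p := by
  obtain ⟨p, v, h, -⟩ := exists_map_generator a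
  exact ⟨p, v.mem, h⟩

theorem mono_inducedHom_iff_sat (c : Asg M.carrier A.ctx) (hc : A.fml.Sat M.toStr c) :
    Mono (inducedHom c hc) ↔ (monoFormula A).Sat M.toStr c := by
  rw [mono_iff_injective, sat_monoFormula]
  constructor
  · intro h q _ θ b hb
    obtain ⟨a, a', ha⟩ := exists_hasComponents θ
    obtain ⟨e, e'⟩ := ha.eq_of_sat hc hb
    exact ha.exists_toFree_iff.2 (h q (e.trans e'.symm))
  · intro h s a a' e
    obtain ⟨θ, hθ⟩ := exists_pair a a'
    have := hθ M c hc
    rw [← e] at this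
    exact hθ.exists_toFree_iff.1 (h s (exists_mem_ctx_of_synHom a) θ _ this)

/-- The homomorphism `⟨y, y' : q | ⊤⟩ → M` taking the generators to `b` and `b'`. -/
noncomputable def pairHom {M : ModelOf (presheafTheory F)} (b b' : M.carrier q) :
    presented (SynObj.free (presheafTheory F) [q, q]) ⟶ M :=
  inducedHom (A := SynObj.free (presheafTheory F) [q, q]) (Asg.cons b (Asg.cons b' Asg.nil)) trivial

/-- The homomorphism `⟨y, y' : q | y = y'⟩ → M` taking the generators to `b`. -/
noncomputable def diagHom {M : ModelOf (presheafTheory F)} (b : M.carrier q) :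
    presented (SynObj.diag (presheafTheory F) q) ⟶ M :=
  inducedHom (A := SynObj.diag (presheafTheory F) q) (Asg.cons b (Asg.cons b Asg.nil)) rfl

/-- Every homomorphism out of `⟨y, y' : q | ⊤⟩` is given by the images of the generators. -/
theorem hom_eq_pairHom (f : presented (SynObj.free (presheafTheory F) [q, q]) ⟶ M) :
    f = pairHom (f.toFun q (generator (SynObj.free (presheafTheory F) [q, q]) q .vz))
      (f.toFun q (generator (SynObj.free (presheafTheory F) [q, q]) q (.vs .vz))) := by
  refine presented_hom_ext fun s v => (Eq.trans ?_ (inducedHom_generator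
    (A := SynObj.free (presheafTheory F) [q, q]) _ _ v).symm)
  rcases v with _ | _ | v
  · rfl
  · rfl
  · nomatch v

theorem pairHom_inj {b b' d d' : M.carrier q} (h : pairHom b b' = pairHom d d') :
    b = d ∧ b' = d' := by
  have key (v : Var [q, q] q) : Asg.cons b (Asg.cons b' Asg.nil) q v =
      Asg.cons d (Asg.cons d' Asg.nil) q v := by
    rw [← inducedHom_generator (A := SynObj.free (presheafTheory F) [q, q])
      (Asg.cons b (Asg.cons b' Asg.nil)) trivial v,
      ← inducedHom_generator (A := SynObj.free (presheafTheory F) [q, q])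
      (Asg.cons d (Asg.cons d' Asg.nil)) trivial v]
    exact congrFun (congrFun (congrArg Str.Hom.toFun h) q) _
  exact ⟨key .vz, key (.vs .vz)⟩

theorem diagQuotient_comp (k : presented (SynObj.diag (presheafTheory F) q) ⟶ M) :
    diagQuotient q ≫ k =
      pairHom (k.toFun q (generator (SynObj.diag (presheafTheory F) q) q .vz))
        (k.toFun q (generator (SynObj.diag (presheafTheory F) q) q .vz)) := by
  have hg (v : Var [q, q] q) := inducedHom_generator
    (A := SynObj.free (presheafTheory F) [q, q]) (M := presented (SynObj.diag (presheafTheory F) q))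
    (generator (SynObj.diag (presheafTheory F) q)) trivial v
  rw [hom_eq_pairHom (diagQuotient q ≫ k)]
  congr 1
  · exact congrArg (k.toFun q) (hg .vz)
  · exact congrArg (k.toFun q) ((hg (.vs .vz)).trans (generator_diag q).symm)

theorem diagQuotient_comp_diagHom (b : M.carrier q) :
    diagQuotient q ≫ diagHom b = pairHom b b := by
  rw [diagQuotient_comp]
  have : (diagHom b).toFun q (generator (SynObj.diag (presheafTheory F) q) q .vz) = b :=
    inducedHom_generator (A := SynObj.diag (presheafTheory F) q) (Asg.cons b (Asg.cons b Asg.nil))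
      rfl .vz
  rw [this]

theorem pairHom_comp {N : ModelOf (presheafTheory F)} (b b' : N.carrier q) (h : N ⟶ M) :
    pairHom b b' ≫ h = pairHom (h.toFun q b) (h.toFun q b') := by
  have hg (v : Var [q, q] q) := inducedHom_generator
    (A := SynObj.free (presheafTheory F) [q, q]) (Asg.cons b (Asg.cons b' Asg.nil)) trivial v
  rw [hom_eq_pairHom (pairHom b b' ≫ h)]
  congr 1
  · exact congrArg (h.toFun q) (hg .vz)
  · exact congrArg (h.toFun q) (hg (.vs .vz))

/-- Diagonals exist at `q` if and only if the homomorphism is injective at `q`. -/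
theorem hasDiagonals_iff_injective {N M : ModelOf (presheafTheory F)} (h : N ⟶ M) (q : F) :
    HasDiagonals h q ↔ Function.Injective (h.toFun q) := by
  constructor
  · intro hd a b e
    obtain ⟨d, hd⟩ := hd (pairHom a b) (diagHom (h.toFun q a)) (by
      rw [diagQuotient_comp_diagHom, pairHom_comp, e])
    rw [diagQuotient_comp] at hd
    obtain ⟨e, e'⟩ := pairHom_inj hd
    exact e.symm.trans e'
  · intro hi l k e
    rw [diagQuotient_comp, hom_eq_pairHom l, pairHom_comp] at e
    obtain ⟨e, e'⟩ := pairHom_inj e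
    have e := hi (e.symm.trans e')
    refine ⟨diagHom (l.toFun q (generator (SynObj.free (presheafTheory F) [q, q]) q .vz)), ?_⟩
    rw [diagQuotient_comp_diagHom]
    conv_rhs => rw [hom_eq_pairHom l, ← e]

theorem mono_iff_hasDiagonals (h : presented A ⟶ M) :
    Mono h ↔ ∀ q : F, (∃ p ∈ A.ctx, q ≤ p) → HasDiagonals h q := by
  simp only [mono_iff_injective, hasDiagonals_iff_injective]
  exact ⟨fun hi q _ => hi q, fun hi q a => hi q (exists_mem_ctx_of_synHom a) (a₁ := a)⟩

theorem mono_tfae (c : Asg M.carrier A.ctx) (hc : A.fml.Sat M.toStr c) :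
    List.TFAE [
      Mono (inducedHom c hc),
      ∀ q : F, (∃ p ∈ A.ctx, q ≤ p) → HasDiagonals (inducedHom c hc) q,
      (monoFormula A).Sat M.toStr c] := by
  tfae_have 1 ↔ 2 := mono_iff_hasDiagonals _
  tfae_have 1 ↔ 3 := mono_inducedHom_iff_sat c hc
  tfae_finish

/-- A homomorphism out of `⟨x : p | ⊤⟩` is monic if and only if the image of `x` satisfies
`Mono[p]`. -/
theorem mono_iff_sat_monoFormula_free {p : F}
    (h : presented (SynObj.free (presheafTheory F) [p]) ⟶ M) :
    Mono h ↔ (monoFormula (SynObj.free (presheafTheory F) [p])).Sat M.toStr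
      (Asg.cons (h.toFun p (generator (SynObj.free (presheafTheory F) [p]) p .vz)) Asg.nil) := by
  refine Iff.trans ?_ (mono_inducedHom_iff_sat (A := SynObj.free (presheafTheory F) [p]) _ trivial)
  refine iff_of_eq (congrArg Mono (presented_hom_ext fun s v => ?_))
  refine Eq.trans ?_ (inducedHom_generator (A := SynObj.free (presheafTheory F) [p]) _ _ v).symm
  rcases v with _ | v
  · rfl
  · nomatch v

end MonoFormula

section PresheafPaths

variable {F : Type u} [PartialOrder F]

/-! ### Presheaves and models -/

/-- The presheaf underlying a model. -/
def presheafOfModel (M : ModelOf (presheafTheory F)) : Fᵒᵖ ⥤ Type u where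
  obj p := M.carrier p.unop
  map f := ↾(M.map (leOfHom f.unop))
  map_id p := by ext a; exact M.map_refl a
  map_comp f g := by ext a; exact (M.map_map _ _ a).symm

theorem isEquivalence_presheafToMod : (presheafToMod F).IsEquivalence where
  faithful := ⟨fun {X Y f g} h => by
    ext p a
    exact congrFun (congrFun (congrArg Str.Hom.toFun h) p.unop) a⟩
  full := ⟨fun {X Y} h =>
    ⟨{ app p := ↾(h.toFun p.unop)
       naturality p q f := by ext a; exact h.map_app (leOfHom f.unop) a }, rfl⟩⟩
  essSurj := ⟨fun M => ⟨presheafOfModel M,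
    ⟨{ hom := ⟨fun _ a => a, fun _ _ => rfl⟩
       inv := ⟨fun _ a => a, fun _ _ => rfl⟩
       hom_inv_id := rfl
       inv_hom_id := rfl }⟩⟩⟩

/-! ### Paths in presheaves -/

/-- Subobjects of a presheaf may be replaced by subpresheaves. -/
theorem isPath_iff_subfunctor (P : Fᵒᵖ ⥤ Type u) :
    IsPath P ↔ Finite (Subfunctor P) ∧ ∀ A B : Subfunctor P, A ≤ B ∨ B ≤ A := by
  have e := Subfunctor.orderIsoSubobject (F := P)
  refine and_congr e.toEquiv.symm.finite_iff ⟨fun h A B => ?_, fun h A B => ?_⟩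
  · simpa using h (e A) (e B)
  · simpa using h (e.symm A) (e.symm B)

/-- Subpresheaves of a representable are determined by the elements at which they are inhabited,
which form a lower set of the finite chain `↓p`. -/
theorem isPath_yoneda (hF : IsForest F) (p : F) : IsPath (yoneda.obj p) := by
  rw [isPath_iff_subfunctor]
  constructor
  · have := (hF p).1.to_subtype
    refine Finite.of_injective
      (fun A : Subfunctor (yoneda.obj p) =>
        {q : Set.Iic p | (homOfLE q.2 : q.1 ⟶ p) ∈ A.obj (op q.1)}) fun A B h => ?_
    ext q f
    exact Set.ext_iff.1 h ⟨q.unop, leOfHom f⟩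
  · intro A B
    by_contra! hAB
    obtain ⟨h, h'⟩ := hAB
    simp only [Subfunctor.le_def, not_forall, Set.not_subset] at h h'
    obtain ⟨q, f, hf, hf'⟩ := h
    obtain ⟨r, g, hg, hg'⟩ := h'
    have main {A : Subfunctor (yoneda.obj p)} {q r : Fᵒᵖ} {f : (yoneda.obj p).obj q}
        {g : (yoneda.obj p).obj r} (hf : f ∈ A.obj q) (h : r.unop ≤ q.unop) : g ∈ A.obj r :=
      A.map (homOfLE h).op hf
    rcases eq_or_ne q.unop r.unop with e | e
    · exact hg' (main hf e.ge)
    · rcases (hF p).2 (leOfHom f) (leOfHom g) e with e | e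
      · exact hf' (main hg e)
      · exact hg' (main hf e)

/-- The presheaf `F(-, p)`, as a model, is `⟨x : p | ⊤⟩`. -/
theorem exists_iso_presented_free (p : F) :
    ∃ e : presented (SynObj.free (presheafTheory F) [p]) ≅ (presheafToMod F).obj (yoneda.obj p),
      e.hom.toFun p (generator (SynObj.free (presheafTheory F) [p]) p .vz) = 𝟙 p := by
  let f : presented (SynObj.free (presheafTheory F) [p]) ⟶ (presheafToMod F).obj (yoneda.obj p) :=
    inducedHom (A := SynObj.free (presheafTheory F) [p])
      (M := (presheafToMod F).obj (yoneda.obj p)) (Asg.cons (𝟙 p) Asg.nil) trivial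
  let g : (presheafToMod F).obj (yoneda.obj p) ⟶ presented (SynObj.free (presheafTheory F) [p]) :=
    ⟨fun s a => (presented (SynObj.free (presheafTheory F) [p])).map (leOfHom a)
      (generator (SynObj.free (presheafTheory F) [p]) p .vz), fun h a =>
        ((presented (SynObj.free (presheafTheory F) [p])).map_map h (leOfHom a) _).symm⟩
  have hf : f.toFun p (generator (SynObj.free (presheafTheory F) [p]) p .vz) = 𝟙 p :=
    inducedHom_generator (A := SynObj.free (presheafTheory F) [p]) _ _ .vz
  refine ⟨⟨f, g, presented_hom_ext fun s v => ?_, ?_⟩, hf⟩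
  · rcases v with _ | v
    · change g.toFun p (f.toFun p (generator (SynObj.free (presheafTheory F) [p]) p .vz)) =
        generator (SynObj.free (presheafTheory F) [p]) p .vz
      rw [hf]
      exact (presented (SynObj.free (presheafTheory F) [p])).map_refl
        (generator (SynObj.free (presheafTheory F) [p]) p .vz)
    · nomatch v
  · refine Str.Hom.ext ?_
    funext s a
    exact Subsingleton.elim (α := s ⟶ p) _ _

/-- `Mono[p]` defines the embeddings of the path `F(-, p)`. -/
theorem mono_yoneda_iff_sat {p : F} {X : Fᵒᵖ ⥤ Type u} (h : yoneda.obj p ⟶ X) :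
    Mono h ↔ (monoFormula (SynObj.free (presheafTheory F) [p])).Sat
      (modelOfPresheaf X).toStr (Asg.cons (yonedaEquiv h) Asg.nil) := by
  have := isEquivalence_presheafToMod (F := F)
  obtain ⟨e, he⟩ := exists_iso_presented_free p
  have h1 : Mono h ↔ Mono (e.hom ≫ (presheafToMod F).map h) := by
    rw [mono_comp_iff_of_isIso, Functor.mono_map_iff_mono]
  rw [h1]
  -- the composite takes the generator to the element corresponding to `h` under the Yoneda lemma
  refine (mono_iff_sat_monoFormula_free _).trans (iff_of_eq ?_)
  congr 2

/-- The elements of a path generate a finite chain of subpresheaves. If there are any, the largest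
of these is the whole of the path, which is then a quotient of a representable. -/
theorem isInitial_or_exists_yoneda_iso {P : Fᵒᵖ ⥤ Type u} (hP : IsPath P) :
    (∃ p : F, Nonempty (yoneda.obj p ≅ P)) ∨ ∀ q, IsEmpty (P.obj q) := by
  rw [isPath_iff_subfunctor] at hP
  obtain ⟨hfin, hchain⟩ := hP
  by_cases hne : Nonempty (Σ q, P.obj q)
  · left
    obtain ⟨⟨p, x⟩, -, hx⟩ := (Set.toFinite _).exists_maximalFor'
      (fun a : Σ q, P.obj q => Subfunctor.ofSection a.2) Set.univ ⟨hne.some, trivial⟩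
    have hgen {q : Fᵒᵖ} (y : P.obj q) : ∃ f : p ⟶ q, P.map f x = y := by
      have : Subfunctor.ofSection y ≤ Subfunctor.ofSection x :=
        (hchain (Subfunctor.ofSection y) (Subfunctor.ofSection x)).elim id
          fun h => hx (j := ⟨q, y⟩) trivial h
      exact (Subfunctor.ofSection_le_iff _ _).1 this
    have : IsIso (yonedaEquiv.symm x : yoneda.obj p.unop ⟶ P) := by
      rw [NatTrans.isIso_iff_isIso_app]
      intro q
      rw [isIso_iff_bijective]
      refine ⟨fun a b _ => Subsingleton.elim (α := q.unop ⟶ p.unop) _ _, fun y => ?_⟩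
      obtain ⟨f, rfl⟩ := hgen y
      exact ⟨f.unop, yonedaEquiv_symm_app_apply _ _ _⟩
    exact ⟨p.unop, ⟨asIso (yonedaEquiv.symm x)⟩⟩
  · right
    exact fun q => ⟨fun a => hne ⟨⟨q, a⟩⟩⟩

theorem nonempty_isInitial_of_isEmpty {P : Fᵒᵖ ⥤ Type u} (hP : ∀ q, IsEmpty (P.obj q)) :
    Nonempty (Limits.IsInitial P) :=
  ⟨Limits.IsInitial.ofUniqueHom
    (fun X =>
      { app q := ↾fun a => ((hP q).false a).elim
        naturality q r f := by ext a; exact ((hP q).false a).elim })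
    fun X m => by ext q a; exact ((hP q).false a).elim⟩

theorem mono_of_isEmpty {P X : Fᵒᵖ ⥤ Type u} (hP : ∀ q, IsEmpty (P.obj q)) (h : P ⟶ X) :
    Mono h := by
  refine ⟨fun {Z} f g _ => ?_⟩
  ext q a
  exact ((hP q).false (f.app q a)).elim

end PresheafPaths

end ForestLogic

theorem mainTheorem11 (F : Type u) [PartialOrder F] (hF : IsForest F) :
    -- presheaves on `F` are the models of the theory of functors
    (presheafToMod F).IsEquivalence ∧
    -- the formula is finite and defines monomorphisms with finitely presentable domain
    (∀ A : SynObj (presheafTheory F),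
      (monoFormula A).IsFinite ∧
      ∀ (M : ModelOf (presheafTheory F)) (c : Asg M.carrier A.ctx) (hc : A.fml.Sat M.toStr c)
        (h : presented A ⟶ M), h = inducedHom c hc →
        List.TFAE [
          Mono h,
          ∀ q : F, (∃ p ∈ A.ctx, q ≤ p) → HasDiagonals h q,
          (monoFormula A).Sat M.toStr c]) ∧
    -- the instance of the models `⟨x : p | ⊤⟩`
    (∀ (p : F) (M : ModelOf (presheafTheory F))
        (h : presented (SynObj.free (presheafTheory F) [p]) ⟶ M),
      Mono h ↔ (monoFormula (SynObj.free (presheafTheory F) [p])).Sat M.toStr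
        (Asg.cons (h.toFun p (generator (SynObj.free (presheafTheory F) [p]) p .vz)) Asg.nil)) ∧
    -- path embeddings in presheaves: the representables are paths, with definable embeddings
    (∀ p : F, IsPath (yoneda.obj p) ∧
      ∀ (X : Fᵒᵖ ⥤ Type u) (h : yoneda.obj p ⟶ X),
        Mono h ↔ (monoFormula (SynObj.free (presheafTheory F) [p])).Sat
          (modelOfPresheaf X).toStr (Asg.cons (yonedaEquiv h) Asg.nil)) ∧
    -- every other path is initial, and then all morphisms out of it are monic
    (∀ P : Fᵒᵖ ⥤ Type u, IsPath P →
      (∃ p : F, Nonempty (yoneda.obj p ≅ P)) ∨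
      (Nonempty (Limits.IsInitial P) ∧ ∀ (X : Fᵒᵖ ⥤ Type u) (h : P ⟶ X), Mono h)) := by
  refine ⟨isEquivalence_presheafToMod, fun A => ⟨isFinite_monoFormula hF A, ?_⟩,
    fun p M h => mono_iff_sat_monoFormula_free h,
    fun p => ⟨isPath_yoneda hF p, fun X h => mono_yoneda_iff_sat h⟩, fun P hP => ?_⟩
  · rintro M c hc h rfl
    exact mono_tfae c hc
  · exact (isInitial_or_exists_yoneda_iso hP).imp_right fun h =>
      ⟨nonempty_isInitial_of_isEmpty h, fun X f => mono_of_isEmpty h f⟩
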